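/- Let $p$ be an odd prime and let $m,k$ be positive integers; put $d=\gcd(m,k)$ and assume $m/d\ge 3$ and $1\le v_2(m)<v_2(k)$, where $v_2$ denotes the $2$-adic valuation (so $m$, $k$ and $d$ are even). Let $\pi$ be a primitive element of $\mathbb{F}_{p^m}$, let $h_1(x)$ and $h_2(x)$ be the minimal polynomials over $\mathbb{F}_p$ of $-\pi^{-1}$ and $\pi^{-(p^k+1)/2}$, and let $\mathrm{Tr}$ be the trace from $\mathbb{F}_{p^m}$ to $\mathbb{F}_p$. Then $$\mathcal{C}=\Big\{\big(\mathrm{Tr}(\alpha\pi^{\frac{p^k+1}{2}i}+\beta(-\pi)^i)\big)_{i=0}^{p^m-2} : \alpha,\beta\in\mathbb{F}_{p^m}\Big\}$$ is a cyclic code over $\mathbb{F}_p$ of length $p^m-1$ and dimension $2m$ with parity-check polynomial $h_1(x)h_2(x)$; that is, as an ideal of $\mathbb{F}_p[x]/(x^{p^m-1}-1)$ it is generated by $(x^{p^m-1}-1)/(h_1(x)h_2(x))$. Its weight distribution is given by the following table, in which every weight that is not listed has frequency $0$ and the frequencies of rows with equal weights are added (for instance, $p^{d/2}-1=2$ when $p=3$,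 $d=2$). $$\begin{array}{ll} \text{Weight} & \text{Frequency}\\ \hline 0 & 1\\ p^{m-1}(p-1)+\frac12(p-1)(p^d-1)p^{\frac m2-1} & (p^{m-d}-1)(p^m-1)/(p^{2d}-1)\\ p^{m-1}(p-1)-\frac12(p-1)(p^d-1)p^{\frac m2-1} & (p^{m-d}-1)(p^m-1)/(p^{2d}-1)\\ p^{m-1}(p-1)+\frac12(p-1)(p^{\frac d2}-1)p^{\frac m2-1} & \frac12p^{\frac{m-d}2}(p^{\frac{m-d}2}-1)(p^m-1)\\ p^{m-1}(p-1)+\frac12(p-1)(p^{\frac d2}+1)p^{\frac m2-1} & \frac12p^{\frac{m-d}2}(p^{\frac{m-d}2}-1)(p^m-1)\\ p^{m-1}(p-1)-\frac12(p-1)(p^{\frac d2}+1)p^{\frac m2-1} & \frac12p^{\frac{m-d}2}(p^{\frac{m-d}2}+1)(p^m-1)\\ p^{m-1}(p-1)-\frac12(p-1)(p^{\frac d2}-1)p^{\frac m2-1} & \frac12p^{\frac{m-d}2}(p^{\frac{m-d}2}+1)(p^m-1)\\ p^{m-1}(p-1)+(p-1)p^{\frac m2-1} & \frac14(p^d-1)(p^{2m}-1)/(p^d+1)\\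 p^{m-1}(p-1)-(p-1)p^{\frac m2-1} & \frac14(p^d-1)(p^{2m}-1)/(p^d+1)\\ p^{m-1}(p-1) & \frac12(p^{m+d}-3p^m+p^d+1)(p^m-1)/(p^d-1) \end{array}$$ -/

import Mathlib

open Polynomial

/-- A linear code `C` of length `n` is cyclic if `(c₀, …, c_{n-1}) ∈ C` implies
`(c_{n-1}, c₀, …, c_{n-2}) ∈ C`; here `finRotate n` is the permutation `i ↦ i + 1 mod n`. -/
def IsCyclicCode {K : Type*} [Field K] {n : ℕ} (C : Submodule K (Fin n → K)) : Prop :=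
  ∀ c ∈ C, (fun i => c ((finRotate n).symm i)) ∈ C

/-- The polynomial `c₀ + c₁ X + ⋯ + c_{n-1} X^{n-1}` of a word. -/
noncomputable def wordPolynomial {K : Type*} [Field K] {n : ℕ} (c : Fin n → K) : K[X] :=
  ∑ i : Fin n, Polynomial.C (c i) * X ^ (i : ℕ)

/-- `h` is the parity-check polynomial of the code `C` of length `n`: there is a monic `g` with
`g * h = X ^ n - 1` such that the words of `C`, read as residue classes, are exactly the elements
of the ideal of `K[X] / (X ^ n - 1)` generated by `g`. -/
def HasParityCheckPolynomial {K : Type*} [Field K] {n : ℕ}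
    (C : Submodule K (Fin n → K)) (h : K[X]) : Prop :=
  ∃ g : K[X], g.Monic ∧ g * h = X ^ n - 1 ∧
    ∀ c : Fin n → K, c ∈ C ↔
      Ideal.Quotient.mk (Ideal.span {(X ^ n - 1 : K[X])}) (wordPolynomial c) ∈
        Ideal.span {Ideal.Quotient.mk (Ideal.span {(X ^ n - 1 : K[X])}) g}

/-- `A_w`: the number of codewords of Hamming weight `w`. -/
noncomputable def weightFrequency {K : Type*} [Field K] [DecidableEq K] {n : ℕ}
    (C : Submodule K (Fin n → K)) (w : ℕ) : ℕ :=
  Nat.card {c : Fin n → K // c ∈ C ∧ hammingNorm c = w}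

/-- The code of all words `(Tr(α π^{(p^k+1)/2 · i} + β (-π)^i))`, `0 ≤ i ≤ p^m - 2`, for
`α, β ∈ F`, where `Tr` is the trace from `F` to `𝔽_p`. -/
noncomputable def traceCode (p m k : ℕ) [Fact p.Prime] {F : Type*} [Field F] [Algebra (ZMod p) F]
    (π : F) : Submodule (ZMod p) (Fin (p ^ m - 1) → ZMod p) where
  carrier := {c | ∃ α β : F, ∀ i : Fin (p ^ m - 1),
    c i = Algebra.trace (ZMod p) F
      (α * π ^ ((p ^ k + 1) / 2 * (i : ℕ)) + β * (-π) ^ (i : ℕ))}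
  zero_mem' := ⟨0, 0, fun i => by simp⟩
  add_mem' := by
    rintro a b ⟨α, β, h⟩ ⟨α', β', h'⟩
    refine ⟨α + α', β + β', fun i => ?_⟩
    rw [Pi.add_apply, h i, h' i, ← map_add]
    congr 1
    ring
  smul_mem' := by
    rintro t a ⟨α, β, h⟩
    refine ⟨t • α, t • β, fun i => ?_⟩
    rw [Pi.smul_apply, h i, ← map_smul]
    simp only [smul_add, smul_mul_assoc]

/-- The rows (weight, frequency) of the weight distribution, for parameters `p`, `m`, `d`. -/
def weightTable (p m d : ℕ) : List (ℚ × ℚ) :=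
  let P : ℚ := p
  let B : ℚ := P ^ (m - 1) * (P - 1)
  let E : ℚ := (P - 1) * P ^ (m / 2 - 1)
  let R : ℚ := P ^ ((m - d) / 2)
  [ (0, 1),
    (B + 1 / 2 * (P ^ d - 1) * E, (P ^ (m - d) - 1) * (P ^ m - 1) / (P ^ (2 * d) - 1)),
    (B - 1 / 2 * (P ^ d - 1) * E, (P ^ (m - d) - 1) * (P ^ m - 1) / (P ^ (2 * d) - 1)),
    (B + 1 / 2 * (P ^ (d / 2) - 1) * E, 1 / 2 * R * (R - 1) * (P ^ m - 1)),
    (B + 1 / 2 * (P ^ (d / 2) + 1) * E, 1 / 2 * R * (R - 1) * (P ^ m - 1)),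
    (B - 1 / 2 * (P ^ (d / 2) + 1) * E, 1 / 2 * R * (R + 1) * (P ^ m - 1)),
    (B - 1 / 2 * (P ^ (d / 2) - 1) * E, 1 / 2 * R * (R + 1) * (P ^ m - 1)),
    (B + E, 1 / 4 * (P ^ d - 1) * (P ^ (2 * m) - 1) / (P ^ d + 1)),
    (B - E, 1 / 4 * (P ^ d - 1) * (P ^ (2 * m) - 1) / (P ^ d + 1)),
    (B, 1 / 2 * (P ^ (m + d) - 3 * P ^ m + P ^ d + 1) * (P ^ m - 1) / (P ^ d - 1)) ]

/-- The number of words of weight `w` that a table of rows (weight, frequency) prescribes: the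
frequencies of all rows with weight `w` are added, since different rows may have equal weights. -/
def tableFrequency (t : List (ℚ × ℚ)) (w : ℕ) : ℚ :=
  ((t.filter fun r => r.1 = (w : ℚ)).map fun r => r.2).sum

/-!
A word of the code is governed by two quadratic forms. At an even position `2j` and with `x = π ^ j`
its entry is the trace of `α x ^ (p ^ k + 1) + β x ^ 2`; the odd positions give the form with
coefficients `α π ^ ((p ^ k + 1) / 2)` and `-β π`. Let `σ` be the Frobenius `x ↦ x ^ p ^ k`, let `K`
be its fixed field, which has `p ^ d` elements, and let `q = p ^ m`. Since `m / d` is odd, `σ` has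
no eigenvalue `-1`, and a nonsquare `u` of `K` stays a nonsquare in the big field. Since `k / d` is
even, writing `π = u w²` turns the second form into the one with coefficients `u α` and `-u β`. With
`S (α, β) = ∑ ψ (α x σ(x) + β x²)`, where `ψ` is the trace character, the weight is determined by
`S (α, β) + S (u α, -u β)` (`two_mul_hammingNorm`).

As `x σ(x) = τ(x)²` for a permutation `τ`, scaling reduces to `α = 1` and `α = u`, that is, to the
sums `A b = S (1, b)` and `A' b = S (u, u b)`. No classification of quadratic forms is used.
Squaring gives `(A b)² = (A' b)² = q * #rad b`, where the radical `rad b` is the set of solutions of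
`σ(x) + σ⁻¹(x) + 2 b x = 0`. If `x ≠ 0` is such a solution, the substitution `z = x w` turns the
forms with parameters `b` and `-b` into `∓ x σ(x) (w ∓ σ(w))² / 2`, up to terms `v - σ⁻¹(v)` on
which `ψ` is trivial. Hence `A (-b)` is the quadratic Gauss sum `G` of the big field, and `A b` is
`G` times a quadratic sum over `K`, of value `p ^ d` or `± p ^ (d / 2)` (`formSum_neg_of_mem_rad`,
`formSum_of_mem_rad`). Moreover `b` and `-b` are never both degenerate (`rad_disjoint`).

Counting the pairs `(b, x)` with `x` in the radical, where the radical is a plane exactly when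
`1 / (x σ(x))` has trace zero in `K`, gives the number of `b` with radicals of each size
(`radCount_sq_mul`, `radCount_eq`). The moment `∑ A b * A' b = q` then forces `A' b = -A b` for
nondegenerate `b`, and the moments `∑ A b + A' b` and `∑ A b * A' (-b)` determine the remaining
class sizes (`class_sizes`), hence the whole distribution (`sum_distribution`).

The distribution shows that the value `2 q` is taken by `(0, 0)` only, so `(α, β)` is determined by
its word and the dimension is `2 m`. Evaluating the words at roots of unity shows that they lie in
the ideal generated by `(X ^ (q - 1) - 1) / (h₁ h₂)`, and equality follows by comparing dimensions
(`hasParityCheckPolynomial_range_traceWord`).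
-/

/-! ### Sums over squares and nonsquares -/

/-- If every element of `K` is `z ^ 2` or `u * z ^ 2` with `z ∈ K`, then `x ↦ x ^ 2` and
`x ↦ u * x ^ 2` together cover `K` exactly twice. -/
lemma sum_sq_add_sum_mul_sq {F M : Type*} [Field F] [DecidableEq F] [AddCommMonoid M]
    (K : Finset F) {u : F} (hu : ¬ IsSquare u) (h2 : (2 : F) ≠ 0)
    (hneg : ∀ x ∈ K, -x ∈ K) (hsq : ∀ x ∈ K, x ^ 2 ∈ K) (husq : ∀ x ∈ K, u * x ^ 2 ∈ K)
    (hroot : ∀ y ∈ K, ∃ z ∈ K, y = z ^ 2 ∨ y = u * z ^ 2) (h : F → M) :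
    ∑ x ∈ K, h (x ^ 2) + ∑ x ∈ K, h (u * x ^ 2) = 2 • ∑ x ∈ K, h x := by
  have hu0 : u ≠ 0 := by rintro rfl; exact hu ⟨0, by simp⟩
  have key : ∀ x y : F, x ≠ 0 → x ^ 2 ≠ u * y ^ 2 := by
    intro x y hx he
    have hy : y ≠ 0 := by rintro rfl; exact hx (by simpa using he)
    exact hu ⟨x / y, by field_simp; exact he.symm⟩
  rw [← Finset.sum_fiberwise_of_maps_to' (g := fun x => x ^ 2) hsq h,
    ← Finset.sum_fiberwise_of_maps_to' (g := fun x => u * x ^ 2) husq h,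
    ← Finset.sum_add_distrib, Finset.smul_sum]
  refine Finset.sum_congr rfl fun y hy => ?_
  rw [Finset.sum_const, Finset.sum_const, ← add_smul]
  congr 1
  obtain ⟨z, hz, hyz⟩ := hroot y hy
  by_cases hz0 : z = 0
  · have hy0 : y = 0 := by rcases hyz with h | h <;> rw [h, hz0] <;> simp
    subst hz0 hy0
    have e1 : {x ∈ K | x ^ 2 = 0} = {0} := by ext x; simp; rintro rfl; exact hz
    have e2 : {x ∈ K | u * x ^ 2 = 0} = {0} := by ext x; simp [hu0]; rintro rfl; exact hz
    rw [e1, e2]; simp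
  · have hpm : z ≠ -z := fun h => by
      have h' : 2 * z = 0 := by linear_combination h
      exact (mul_ne_zero h2 hz0) h'
    rcases hyz with rfl | rfl
    · have e1 : {x ∈ K | x ^ 2 = z ^ 2} = {z, -z} := by
        ext x; simp only [Finset.mem_filter, Finset.mem_insert, Finset.mem_singleton,
          sq_eq_sq_iff_eq_or_eq_neg]
        constructor
        · exact fun h => h.2
        · rintro (rfl | rfl)
          · exact ⟨hz, Or.inl rfl⟩
          · exact ⟨hneg _ hz, Or.inr rfl⟩
      have e2 : {x ∈ K | u * x ^ 2 = z ^ 2} = ∅ := by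
        ext x; simp only [Finset.mem_filter, Finset.notMem_empty, iff_false, not_and]
        exact fun _ h => key z x hz0 h.symm
      rw [e1, e2, Finset.card_pair hpm]; simp
    · have e1 : {x ∈ K | u * x ^ 2 = u * z ^ 2} = {z, -z} := by
        ext x; simp only [Finset.mem_filter, Finset.mem_insert, Finset.mem_singleton,
          mul_right_inj' hu0, sq_eq_sq_iff_eq_or_eq_neg]
        constructor
        · exact fun h => h.2
        · rintro (rfl | rfl)
          · exact ⟨hz, Or.inl rfl⟩
          · exact ⟨hneg _ hz, Or.inr rfl⟩
      have e2 : {x ∈ K | x ^ 2 = u * z ^ 2} = ∅ := by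
        ext x; simp only [Finset.mem_filter, Finset.notMem_empty, iff_false, not_and]
        intro _ h
        have hx : x ≠ 0 := by rintro rfl; simp [hu0, hz0] at h
        exact key x z hx h
      rw [e1, e2, Finset.card_pair hpm]; simp

/-- In a finite field a nonsquare times a nonsquare is a square, so every element is `z ^ 2` or
`u * z ^ 2`. -/
lemma exists_eq_sq_or_eq_mul_sq {F : Type*} [Field F] [Finite F] {u : F} (hu : ¬ IsSquare u)
    (y : F) : ∃ z, y = z ^ 2 ∨ y = u * z ^ 2 := by
  have := Fintype.ofFinite F
  classical
  have hu0 : u ≠ 0 := by rintro rfl; exact hu ⟨0, by simp⟩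
  by_cases hy : IsSquare y
  · obtain ⟨z, rfl⟩ := hy
    exact ⟨z, Or.inl (sq z).symm⟩
  · have hy0 : y ≠ 0 := by rintro rfl; exact hy ⟨0, by simp⟩
    have h1 := (quadraticChar_neg_one_iff_not_isSquare).2 hu
    have h2 := (quadraticChar_neg_one_iff_not_isSquare).2 hy
    have h3 : IsSquare (y * u) := by
      rw [← quadraticChar_one_iff_isSquare (mul_ne_zero hy0 hu0), map_mul, h1, h2]; norm_num
    obtain ⟨z, hz⟩ := h3
    refine ⟨z / u, Or.inr ?_⟩
    field_simp
    rw [hz]; ring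

/-! ### Quadratic character sums twisted by a field automorphism -/

/-- The data behind the exponential sums of the code: an automorphism `σ` with no eigenvalue `-1`
(which holds when the order of `σ` is odd), a primitive additive character `ψ` invariant under `σ`,
a nonsquare `u` fixed by `σ`, and a permutation `τ` of the field with `x * σ x = τ x ^ 2`. -/
structure TwistedSetting (F : Type*) [Field F] where
  /-- the automorphism -/
  σ : F ≃+* F
  /-- the additive character -/
  ψ : AddChar F ℂ
  /-- the nonsquare -/
  u : F
  /-- the permutation through which `x * σ x` is a square -/
  τ : F → F
  isPrimitive : ψ.IsPrimitive
  ψ_σ : ∀ x, ψ (σ x) = ψ x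
  eq_zero_of_σ_eq_neg : ∀ x, σ x = -x → x = 0
  σ_u : σ u = u
  not_isSquare_u : ¬ IsSquare u
  isSquare_neg_one : IsSquare (-1 : F)
  isSquare_two : IsSquare (2 : F)
  τ_bijective : Function.Bijective τ
  mul_σ : ∀ x, x * σ x = τ x ^ 2

namespace TwistedSetting

set_option linter.unusedSectionVars false

variable {F : Type*} [Field F] [Fintype F] [DecidableEq F] (T : TwistedSetting F)

/-- The fixed field of `σ`. -/
def fixed : Finset F := {x | T.σ x = x}

/-- The number of elements of the field, as a complex number. -/
local notation "q" => (Fintype.card F : ℂ)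

/-- The number of elements of the fixed field, as a complex number. -/
local notation "q₀" => (Finset.card (TwistedSetting.fixed T) : ℂ)

@[simp] lemma mem_fixed {x : F} : x ∈ T.fixed ↔ T.σ x = x := by simp [fixed]

lemma u_ne_zero : T.u ≠ 0 := by
  intro h; exact T.not_isSquare_u ⟨0, by simp [h]⟩

lemma two_ne (T : TwistedSetting F) : (2 : F) ≠ 0 := by
  intro h
  refine one_ne_zero (T.eq_zero_of_σ_eq_neg 1 ?_)
  rw [map_one]; linear_combination h

lemma ψ_symm (x : F) : T.ψ (T.σ.symm x) = T.ψ x := by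
  rw [← T.ψ_σ, RingEquiv.apply_symm_apply]

lemma σ_eq_of_sq {z : F} (h : T.σ (z ^ 2) = z ^ 2) : T.σ z = z := by
  rw [map_pow, sq_eq_sq_iff_eq_or_eq_neg] at h
  rcases h with h | h
  · exact h
  · rw [T.eq_zero_of_σ_eq_neg z h, map_zero]

lemma exists_sq_neg_one : ∃ i : F, T.σ i = i ∧ i ^ 2 = -1 := by
  obtain ⟨i, hi⟩ := T.isSquare_neg_one
  have hi' : i ^ 2 = -1 := by rw [hi, sq]
  exact ⟨i, T.σ_eq_of_sq (by rw [hi', map_neg, map_one]), hi'⟩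

lemma exists_sq_two : ∃ r : F, T.σ r = r ∧ r ^ 2 = 2 ∧ r ≠ 0 := by
  obtain ⟨r, hr⟩ := T.isSquare_two
  have hr' : r ^ 2 = 2 := by rw [hr, sq]
  refine ⟨r, T.σ_eq_of_sq (by rw [hr', map_ofNat]), hr', ?_⟩
  rintro rfl
  exact T.two_ne (by rw [hr]; ring)

lemma sum_univ_sq {M : Type*} [AddCommMonoid M] (h : F → M) :
    ∑ x, h (x ^ 2) + ∑ x, h (T.u * x ^ 2) = 2 • ∑ x, h x :=
  sum_sq_add_sum_mul_sq Finset.univ T.not_isSquare_u T.two_ne (by simp) (by simp) (by simp)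
    (fun y _ => by
      obtain ⟨z, hz⟩ := exists_eq_sq_or_eq_mul_sq T.not_isSquare_u y
      exact ⟨z, Finset.mem_univ _, hz⟩) h

lemma exists_fixed_eq_sq_or {y : F} (hy : T.σ y = y) :
    ∃ z, T.σ z = z ∧ (y = z ^ 2 ∨ y = T.u * z ^ 2) := by
  obtain ⟨z, hz⟩ := exists_eq_sq_or_eq_mul_sq T.not_isSquare_u y
  refine ⟨z, T.σ_eq_of_sq ?_, hz⟩
  rcases hz with rfl | rfl
  · exact hy
  · rw [map_mul, T.σ_u] at hy
    exact mul_left_cancel₀ T.u_ne_zero hy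

lemma sum_fixed_sq {M : Type*} [AddCommMonoid M] (h : F → M) :
    ∑ x ∈ T.fixed, h (x ^ 2) + ∑ x ∈ T.fixed, h (T.u * x ^ 2) = 2 • ∑ x ∈ T.fixed, h x :=
  sum_sq_add_sum_mul_sq T.fixed T.not_isSquare_u T.two_ne
    (by simp) (by simp +contextual) (by simp +contextual [T.σ_u])
    (fun y hy => by
      obtain ⟨z, hz, h⟩ := T.exists_fixed_eq_sq_or (T.mem_fixed.1 hy)
      exact ⟨z, T.mem_fixed.2 hz, h⟩) h

lemma sum_ψ_mul (a : F) : ∑ x, T.ψ (x * a) = if a = 0 then q else 0 := by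
  have := AddChar.sum_mulShift a T.isPrimitive
  rw [this]; split_ifs <;> simp

/-- The quadratic Gauss sum with coefficient `c`. -/
noncomputable def quadSum (c : F) : ℂ := ∑ x, T.ψ (c * x ^ 2)

/-- The exponential sum of the form `α x σ(x) + β x²`. -/
noncomputable def formSum (α β : F) : ℂ := ∑ x, T.ψ (α * (x * T.σ x) + β * x ^ 2)

lemma formSum_scale {c : F} (hc : c ≠ 0) (α β : F) :
    T.formSum (α * (c * T.σ c)) (β * c ^ 2) = T.formSum α β := by
  unfold formSum
  refine Fintype.sum_equiv (Equiv.mulLeft₀ c hc) _ _ fun x => ?_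
  simp only [Equiv.mulLeft₀_apply, map_mul]
  congr 1; ring

lemma formSum_fixed_scale {c : F} (hc : T.σ c = c) (hc0 : c ≠ 0) (α β : F) :
    T.formSum (c ^ 2 * α) (c ^ 2 * β) = T.formSum α β := by
  rw [← T.formSum_scale hc0 α β, hc]
  congr 1 <;> ring

lemma formSum_zero_left (β : F) : T.formSum 0 β = T.quadSum β := by
  simp [formSum, quadSum]

lemma formSum_zero_right (α : F) : T.formSum α 0 = T.quadSum α := by
  unfold formSum quadSum
  refine Fintype.sum_equiv (Equiv.ofBijective T.τ T.τ_bijective) _ _ fun x => ?_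
  simp [T.mul_σ]

lemma formSum_neg (α β : F) : T.formSum (-α) (-β) = T.formSum α β := by
  obtain ⟨i, hi, hi2⟩ := T.exists_sq_neg_one
  have hi0 : i ≠ 0 := by rintro rfl; simp at hi2
  rw [← T.formSum_fixed_scale hi hi0 α β, hi2]
  congr 1 <;> ring

lemma quadSum_sq_mul {c : F} (hc : c ≠ 0) (e : F) : T.quadSum (c ^ 2 * e) = T.quadSum e := by
  rw [← formSum_zero_left, ← formSum_zero_left, ← T.formSum_scale hc 0 e, zero_mul, mul_comm]

lemma quadSum_neg (e : F) : T.quadSum (-e) = T.quadSum e := by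
  rw [← formSum_zero_left, ← formSum_zero_left, ← T.formSum_neg 0 e, neg_zero]

lemma quadSum_u_mul {e : F} (he : e ≠ 0) : T.quadSum (T.u * e) = - T.quadSum e := by
  have h := T.sum_univ_sq fun x => T.ψ (x * e)
  rw [T.sum_ψ_mul, if_neg he, smul_zero] at h
  rw [eq_neg_iff_add_eq_zero, add_comm, ← h]
  unfold quadSum
  congr 1 <;> exact Finset.sum_congr rfl fun x _ => by congr 1; ring

/-- `(x, y) ↦ (x - y, y)` turns the square of the sum into a sum over the radical of the form. -/
lemma formSum_sq (α β : F) : T.formSum α β ^ 2 =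
    q * ∑ z with α * T.σ z + T.σ.symm (α * z) + 2 * β * z = 0,
      T.ψ (α * (z * T.σ z) + β * z ^ 2) := by
  have h1 : T.formSum α β ^ 2 = T.formSum α β * T.formSum (-α) (-β) := by
    rw [formSum_neg, sq]
  rw [h1]
  unfold formSum
  rw [Finset.sum_mul_sum, Finset.sum_comm]
  have h2 : ∀ y : F, ∑ x, T.ψ (α * (x * T.σ x) + β * x ^ 2) * T.ψ (-α * (y * T.σ y) + -β * y ^ 2)
      = ∑ z, T.ψ (α * (z * T.σ z) + β * z ^ 2) *
        T.ψ (y * (α * T.σ z + T.σ.symm (α * z) + 2 * β * z)) := by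
    intro y
    refine Fintype.sum_equiv (Equiv.subRight y) _ _ fun x => ?_
    simp only [Equiv.subRight_apply]
    obtain ⟨z, rfl⟩ : ∃ z, x = z + y := ⟨x - y, by ring⟩
    rw [add_sub_cancel_right]
    have h3 : T.ψ (y * (α * T.σ z + T.σ.symm (α * z) + 2 * β * z)) =
        T.ψ (y * (α * T.σ z + 2 * β * z)) * T.ψ (T.σ y * (α * z)) := by
      rw [← T.ψ_symm (T.σ y * (α * z)), ← AddChar.map_add_eq_mul]
      congr 1
      rw [map_mul T.σ.symm (T.σ y), RingEquiv.symm_apply_apply]; ring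
    rw [h3, ← AddChar.map_add_eq_mul, ← AddChar.map_add_eq_mul, ← AddChar.map_add_eq_mul]
    congr 1
    rw [map_add]; ring
  simp_rw [h2]
  rw [Finset.sum_comm]
  simp_rw [← Finset.mul_sum, T.sum_ψ_mul]
  rw [Finset.mul_sum, Finset.sum_filter]
  refine Finset.sum_congr rfl fun z _ => ?_
  split_ifs
  · ring
  · simp

/-- The radical of the form `x σ(x) + b x²` with respect to the trace. -/
def rad (b : F) : Finset F := {z | T.σ z + T.σ.symm z + 2 * b * z = 0}

@[simp] lemma mem_rad {b z : F} : z ∈ T.rad b ↔ T.σ z + T.σ.symm z + 2 * b * z = 0 := by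
  simp [rad]

lemma formSum_sq_eq_card_rad {s : F} (hs : T.σ s = s) (hs0 : s ≠ 0) (b : F) :
    T.formSum s (s * b) ^ 2 = q * (T.rad b).card := by
  have hs' : T.σ.symm s = s := by rw [RingEquiv.symm_apply_eq, hs]
  rw [T.formSum_sq]
  congr 1
  have h1 : Finset.univ.filter (fun z => s * T.σ z + T.σ.symm (s * z) + 2 * (s * b) * z = 0) =
      T.rad b := by
    ext z
    simp only [Finset.mem_filter, Finset.mem_univ, true_and, mem_rad, map_mul, hs']
    rw [show s * T.σ z + s * T.σ.symm z + 2 * (s * b) * z =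
      s * (T.σ z + T.σ.symm z + 2 * b * z) by ring]
    simp [hs0]
  rw [h1, Finset.card_eq_sum_ones]
  push_cast
  refine Finset.sum_congr rfl fun z hz => ?_
  have h2 := T.two_ne
  have hr' : T.σ.symm 2 = 2 := by rw [RingEquiv.symm_apply_eq, map_ofNat]
  rw [mem_rad] at hz
  -- on the radical the form takes values `w - σ⁻¹ w`, on which `ψ` is trivial
  have h3 : s * (z * T.σ z) + s * b * z ^ 2 =
      s * (z * T.σ z) / 2 - T.σ.symm (s * (z * T.σ z) / 2) := by
    rw [map_div₀, hr', map_mul, map_mul, hs', RingEquiv.symm_apply_apply]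
    field_simp
    linear_combination z * hz
  rw [h3, AddChar.map_sub_eq_div, T.ψ_symm, div_self (AddChar.val_isUnit _ _).ne_zero]

lemma zero_mem_rad (b : F) : 0 ∈ T.rad b := by simp

/-- The forms with parameters `b` and `-b` are not both degenerate: for radical vectors `x`, `y`
of the two, the symmetric Wronskian `y σ(x) + x σ(y)` is negated by `σ`. -/
lemma rad_disjoint {b x y : F} (hx : x ∈ T.rad b) (hy : y ∈ T.rad (-b)) (hx0 : x ≠ 0) :
    y = 0 := by
  rw [mem_rad] at hx hy
  by_contra hy0
  have hW : T.σ.symm (y * T.σ x + x * T.σ y) = -(y * T.σ x + x * T.σ y) := by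
    simp only [map_add, map_mul, RingEquiv.symm_apply_apply]
    linear_combination y * hx + x * hy
  rw [RingEquiv.symm_apply_eq, map_neg, eq_comm, neg_eq_iff_eq_neg] at hW
  have hW0 := T.eq_zero_of_σ_eq_neg _ hW
  have : T.σ (x / y) = -(x / y) := by
    have hσy : T.σ y ≠ 0 := by simpa using hy0
    rw [map_div₀]; field_simp
    linear_combination hW0
  have := T.eq_zero_of_σ_eq_neg _ this
  simp_all

/-! ### The character sum over the fixed field -/

/-- `ψ` is trivial on the line `fixed • e`; in terms of traces, the trace of `e` to the fixed field
vanishes. -/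
def Orth (e : F) : Prop := ∀ l, T.σ l = l → T.ψ (l * e) = 1

lemma sum_fixed_ψ [DecidablePred T.Orth] (e : F) :
    ∑ l ∈ T.fixed, T.ψ (l * e) = if T.Orth e then q₀ else 0 := by
  split_ifs with h
  · rw [Finset.sum_congr rfl fun l hl => h l (T.mem_fixed.1 hl)]; simp
  · unfold Orth at h
    push Not at h
    obtain ⟨l₀, hl₀, hne⟩ := h
    have h1 : T.ψ (l₀ * e) * ∑ l ∈ T.fixed, T.ψ (l * e) = ∑ l ∈ T.fixed, T.ψ (l * e) := by
      rw [Finset.mul_sum]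
      refine Finset.sum_nbij' (fun l => l₀ + l) (fun l => l - l₀) ?_ ?_ ?_ ?_ ?_
      · intro l hl; simp only [mem_fixed, map_add] at *; rw [hl, hl₀]
      · intro l hl; simp only [mem_fixed, map_sub] at *; rw [hl, hl₀]
      · intro l _; ring
      · intro l _; ring
      · intro l _; rw [← AddChar.map_add_eq_mul, add_mul]
    by_contra h0
    exact hne (mul_right_cancel₀ h0 (h1.trans (one_mul _).symm))

lemma orth_mul_iff {c : F} (hc : T.σ c = c) (hc0 : c ≠ 0) (e : F) :
    T.Orth (c * e) ↔ T.Orth e := by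
  constructor
  · intro h l hl
    have := h (l / c) (by rw [map_div₀, hl, hc])
    rwa [← mul_assoc, div_mul_cancel₀ _ hc0] at this
  · intro h l hl
    rw [← mul_assoc]
    exact h _ (by rw [map_mul, hl, hc])

/-- The quadratic sum over the fixed field. -/
noncomputable def fixedSum (e : F) : ℂ := ∑ l ∈ T.fixed, T.ψ (l ^ 2 * e)

lemma fixedSum_of_orth {e : F} (h : T.Orth e) : T.fixedSum e = q₀ := by
  unfold fixedSum
  rw [Finset.sum_congr rfl fun l hl => h (l ^ 2) (by rw [map_pow, T.mem_fixed.1 hl])]; simp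

lemma fixedSum_u_mul {e : F} (h : ¬ T.Orth e) : T.fixedSum (T.u * e) = - T.fixedSum e := by
  classical
  have h1 := T.sum_fixed_sq fun x => T.ψ (x * e)
  rw [T.sum_fixed_ψ, if_neg h, smul_zero] at h1
  rw [eq_neg_iff_add_eq_zero, add_comm, ← h1]
  unfold fixedSum
  congr 1; exact Finset.sum_congr rfl fun x _ => by congr 1; ring

lemma fixedSum_sq {e : F} (h : ¬ T.Orth e) : T.fixedSum e ^ 2 = q₀ := by
  classical
  obtain ⟨i, hi, hi2⟩ := T.exists_sq_neg_one
  have hi0 : i ≠ 0 := by rintro rfl; simp at hi2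
  have h1 : T.fixedSum e = ∑ l ∈ T.fixed, T.ψ (-(l ^ 2 * e)) := by
    refine Finset.sum_nbij' (fun l => l / i) (fun l => l * i) ?_ ?_ ?_ ?_ ?_
    · intro l hl; simp only [mem_fixed, map_div₀] at *; rw [hl, hi]
    · intro l hl; simp only [mem_fixed, map_mul] at *; rw [hl, hi]
    · intro l _; field_simp
    · intro l _; field_simp
    · intro l _; rw [div_pow, hi2]; congr 1; ring
  have h2 : ∀ y ∈ T.fixed, ∑ x ∈ T.fixed, T.ψ (x ^ 2 * e) * T.ψ (-(y ^ 2 * e)) =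
      ∑ z ∈ T.fixed, T.ψ (z ^ 2 * e) * T.ψ (y * (2 * z * e)) := by
    intro y hy
    refine Finset.sum_nbij' (fun x => x - y) (fun z => z + y) ?_ ?_ ?_ ?_ ?_
    · intro l hl; simp only [mem_fixed, map_sub] at *; rw [hl, hy]
    · intro l hl; simp only [mem_fixed, map_add] at *; rw [hl, hy]
    · intro l _; ring
    · intro l _; ring
    · intro x _
      rw [← AddChar.map_add_eq_mul, ← AddChar.map_add_eq_mul]
      congr 1; ring
  rw [sq]
  nth_rewrite 2 [h1]
  unfold fixedSum
  rw [Finset.sum_mul_sum, Finset.sum_comm, Finset.sum_congr rfl h2, Finset.sum_comm]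
  simp_rw [← Finset.mul_sum, T.sum_fixed_ψ]
  rw [Finset.sum_eq_single_of_mem 0 (by simp)]
  · have h0 : T.Orth (2 * 0 * e) := fun l _ => by simp
    rw [if_pos h0]; simp
  · intro z hz hz0
    rw [if_neg, mul_zero]
    rwa [T.orth_mul_iff (c := 2 * z) (by rw [map_mul, map_ofNat, T.mem_fixed.1 hz])
      (mul_ne_zero T.two_ne hz0)]

/-! ### Degenerate forms -/

/-- The fibres of `w ↦ w - σ w` (additive Hilbert 90), detected by characters of the fixed field. -/
lemma sum_sub_σ (f : F → ℂ) :
    ∑ w, f (w - T.σ w) = ∑ v, f v * ∑ l ∈ T.fixed, T.ψ (l * v) := by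
  have hcard : ∀ v : F, ((Finset.univ.filter fun w => w - T.σ w = v).card : ℂ) =
      ∑ l ∈ T.fixed, T.ψ (l * v) := by
    intro v
    have hq : q ≠ 0 := by simp
    have h1 : q * ((Finset.univ.filter fun w => w - T.σ w = v).card : ℂ) =
        ∑ w, ∑ c, T.ψ (c * (v - (w - T.σ w))) := by
      simp_rw [T.sum_ψ_mul]
      rw [← Finset.sum_filter, Finset.sum_const, nsmul_eq_mul, mul_comm]
      congr 3
      ext w
      simp only [Finset.mem_filter, Finset.mem_univ, true_and, sub_eq_zero]
      exact eq_comm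
    have h2 : ∀ c : F, ∑ w, T.ψ (c * (v - (w - T.σ w))) =
        T.ψ (c * v) * ∑ w, T.ψ (w * (T.σ.symm c - c)) := by
      intro c
      rw [Finset.mul_sum]
      refine Finset.sum_congr rfl fun w _ => ?_
      rw [show c * (v - (w - T.σ w)) = c * v + (-(w * c)) + c * T.σ w by ring,
        AddChar.map_add_eq_mul, ← T.ψ_symm (c * T.σ w), ← AddChar.map_add_eq_mul,
        ← AddChar.map_add_eq_mul, map_mul, RingEquiv.symm_apply_apply]
      congr 1; ring
    refine mul_left_cancel₀ hq ?_
    rw [h1, Finset.sum_comm]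
    simp_rw [h2, T.sum_ψ_mul]
    rw [Finset.mul_sum, fixed, Finset.sum_filter]
    refine Finset.sum_congr rfl fun c _ => ?_
    simp only [sub_eq_zero, RingEquiv.symm_apply_eq, eq_comm (a := c)]
    split_ifs
    · ring
    · simp
  rw [← Finset.sum_fiberwise Finset.univ (fun w => w - T.σ w)]
  refine Finset.sum_congr rfl fun v _ => ?_
  rw [← hcard, mul_comm, ← nsmul_eq_mul, ← Finset.sum_const]
  exact Finset.sum_congr rfl fun w hw => by rw [(Finset.mem_filter.1 hw).2]

lemma quadSum_mul_norm_div_two {x : F} (hx : x ≠ 0) (s : F) :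
    T.quadSum (s * (x * T.σ x) / 2) = T.quadSum s := by
  obtain ⟨r, hr, hr2, hr0⟩ := T.exists_sq_two
  have hτ : T.τ x ≠ 0 := by
    intro h
    have := T.mul_σ x
    rw [h] at this
    simp [hx] at this
  rw [← T.quadSum_sq_mul (div_ne_zero hτ hr0) s, div_pow, ← T.mul_σ, hr2]
  congr 1; ring

/-- For a radical vector `x` of the form with parameter `b`, the substitution `z = x w` turns the
form with parameter `-b` into the full square `x σ(x) (w + σ w)² / 2`. -/
lemma formSum_neg_of_mem_rad {b x s : F} (hs : T.σ s = s) (hx : x ∈ T.rad b)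
    (hx0 : x ≠ 0) : T.formSum s (s * (-b)) = T.quadSum s := by
  have h2 := T.two_ne
  have hs' : T.σ.symm s = s := by rw [RingEquiv.symm_apply_eq, hs]
  have h2' : T.σ.symm 2 = 2 := by rw [RingEquiv.symm_apply_eq, map_ofNat]
  rw [mem_rad] at hx
  have hbij : Function.Bijective fun w => w + T.σ w := by
    rw [← Finite.injective_iff_bijective]
    intro w w' h
    rw [← sub_eq_zero]
    apply T.eq_zero_of_σ_eq_neg
    rw [map_sub]
    linear_combination h
  rw [← T.formSum_scale hx0, ← T.quadSum_mul_norm_div_two hx0 s]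
  refine Fintype.sum_equiv (Equiv.ofBijective _ hbij) _ _ fun w => ?_
  simp only [Equiv.ofBijective_apply]
  have h3 : s * (x * T.σ x) * (w * T.σ w) + s * -b * x ^ 2 * w ^ 2 =
      (s * (x * T.σ x) / 2) * (w + T.σ w) ^ 2 +
      (T.σ.symm (s * (x * T.σ x) / 2 * (T.σ w) ^ 2) - s * (x * T.σ x) / 2 * (T.σ w) ^ 2) := by
    simp only [map_div₀, map_mul, map_pow, hs', h2', RingEquiv.symm_apply_apply]
    field_simp
    linear_combination -(s * w ^ 2) * hx
  rw [h3, AddChar.map_add_eq_mul, AddChar.map_sub_eq_div, T.ψ_symm,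
    div_self (AddChar.val_isUnit _ _).ne_zero, mul_one]

/-- For a radical vector `x` of the form with parameter `b`, the substitution `z = x w` turns that
form into `-x σ(x) (w - σ w)² / 2`, whose sum runs over a hyperplane only; detecting the hyperplane
by characters and completing the square leaves a quadratic sum over the fixed field. -/
lemma formSum_of_mem_rad {b x s : F} (hs : T.σ s = s) (hs0 : s ≠ 0) (hx : x ∈ T.rad b)
    (hx0 : x ≠ 0) :
    T.formSum s (s * b) = T.quadSum s * T.fixedSum (1 / (2 * (s * (x * T.σ x)))) := by
  have h2 := T.two_ne
  have hs' : T.σ.symm s = s := by rw [RingEquiv.symm_apply_eq, hs]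
  have h2' : T.σ.symm 2 = 2 := by rw [RingEquiv.symm_apply_eq, map_ofNat]
  have hσx : T.σ x ≠ 0 := by simpa using hx0
  rw [mem_rad] at hx
  set a := s * (x * T.σ x) with ha
  have ha0 : a ≠ 0 := mul_ne_zero hs0 (mul_ne_zero hx0 hσx)
  have hsum : T.formSum s (s * b) = ∑ w, T.ψ (-(a / 2) * (w - T.σ w) ^ 2) := by
    rw [← T.formSum_scale hx0]
    refine Finset.sum_congr rfl fun w _ => ?_
    have h3 : s * (x * T.σ x) * (w * T.σ w) + s * b * x ^ 2 * w ^ 2 =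
        -(a / 2) * (w - T.σ w) ^ 2 -
        (T.σ.symm (a / 2 * (T.σ w) ^ 2) - a / 2 * (T.σ w) ^ 2) := by
      simp only [ha, map_div₀, map_mul, map_pow, hs', h2', RingEquiv.symm_apply_apply]
      field_simp
      linear_combination (w ^ 2) * hx
    rw [h3, AddChar.map_sub_eq_div, AddChar.map_sub_eq_div, T.ψ_symm,
      div_self (AddChar.val_isUnit _ _).ne_zero, div_one]
  rw [hsum, T.sum_sub_σ (fun v => T.ψ (-(a / 2) * v ^ 2))]
  simp_rw [Finset.mul_sum]
  rw [Finset.sum_comm, fixedSum, Finset.mul_sum]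
  refine Finset.sum_congr rfl fun l _ => ?_
  rw [← T.quadSum_mul_norm_div_two hx0 s, ← ha, ← T.quadSum_neg, quadSum, Finset.sum_mul]
  refine Fintype.sum_equiv (Equiv.subRight (l / a)) _ _ fun v => ?_
  rw [← AddChar.map_add_eq_mul, ← AddChar.map_add_eq_mul, Equiv.subRight_apply]
  congr 1
  field_simp
  ring
/-! ### Counting degenerate forms -/

/-- The exponential sum of `s` times the form `x σ(x) + b x²`. -/
noncomputable def pencilSum (s b : F) : ℂ := T.formSum s (s * b)

lemma pencilSum_sq {s : F} (hs : T.σ s = s) (hs0 : s ≠ 0) (b : F) :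
    T.pencilSum s b ^ 2 = q * (T.rad b).card := T.formSum_sq_eq_card_rad hs hs0 b

lemma card_field_ne_zero : q ≠ 0 := by simp

lemma one_lt_card_fixed : 1 < T.fixed.card :=
  Finset.one_lt_card.2 ⟨0, by simp, 1, by simp, zero_ne_one⟩

lemma card_fixed_ne_zero : q₀ ≠ 0 := by
  have := T.one_lt_card_fixed
  exact_mod_cast (by omega : T.fixed.card ≠ 0)

lemma card_fixed_ne_one : q₀ ≠ 1 := by
  have := T.one_lt_card_fixed
  exact_mod_cast (by omega : T.fixed.card ≠ 1)

lemma card_rad_eq_one_of_neg {b x : F} (hx : x ∈ T.rad b) (hx0 : x ≠ 0) :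
    (T.rad (-b)).card = 1 :=
  Finset.card_eq_one.2 ⟨0, Finset.eq_singleton_iff_unique_mem.2
    ⟨T.zero_mem_rad _, fun _ hy => T.rad_disjoint hx hy hx0⟩⟩

lemma exists_mem_rad {b : F} (h : (T.rad b).card ≠ 1) : ∃ x ∈ T.rad b, x ≠ 0 := by
  by_contra! h'
  exact h (Finset.card_eq_one.2 ⟨0, Finset.eq_singleton_iff_unique_mem.2 ⟨T.zero_mem_rad _, h'⟩⟩)

lemma quadSum_one_sq : T.quadSum 1 ^ 2 = q := by
  have h := T.formSum_sq_eq_card_rad (map_one _) one_ne_zero 0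
  have h1 : (T.rad 0).card = 1 := by
    by_contra h'
    obtain ⟨x, hx, hx0⟩ := T.exists_mem_rad h'
    exact hx0 (T.rad_disjoint hx (by simpa using hx) hx0)
  rw [h1, mul_zero, formSum_zero_right] at h
  simpa using h

lemma quadSum_u : T.quadSum T.u = -T.quadSum 1 := by
  simpa using T.quadSum_u_mul one_ne_zero

lemma mul_σ_ne_zero {x : F} (hx : x ≠ 0) : x * T.σ x ≠ 0 := mul_ne_zero hx (by simpa using hx)

lemma orth_two_mul_iff (a : F) : T.Orth (1 / (2 * a)) ↔ T.Orth (1 / a) := by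
  rw [← T.orth_mul_iff (c := 2⁻¹) (by rw [map_inv₀, map_ofNat]) (inv_ne_zero T.two_ne) (1 / a)]
  rw [show 2⁻¹ * (1 / a) = 1 / (2 * a) by rw [one_div, one_div, mul_inv]]

lemma pencilSum_one_of_mem_rad {b x : F} (hx : x ∈ T.rad b) (hx0 : x ≠ 0) :
    T.pencilSum 1 b = T.quadSum 1 * T.fixedSum (1 / (2 * (x * T.σ x))) := by
  have := T.formSum_of_mem_rad (map_one _) one_ne_zero hx hx0
  rwa [one_mul (x * _)] at this

lemma pencilSum_u_of_mem_rad {b x : F} (hx : x ∈ T.rad b) (hx0 : x ≠ 0) :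
    T.pencilSum T.u b = -(T.quadSum 1 * T.fixedSum (T.u * (1 / (2 * (x * T.σ x))))) := by
  have := T.formSum_of_mem_rad T.σ_u T.u_ne_zero hx hx0
  unfold pencilSum
  rw [this, quadSum_u, neg_mul]
  congr 2
  have hu := T.u_ne_zero
  unfold fixedSum
  refine Finset.sum_nbij' (fun l => l / T.u) (fun l => l * T.u) ?_ ?_ ?_ ?_ ?_
  · intro l hl; simp only [mem_fixed, map_div₀] at *; rw [hl, T.σ_u]
  · intro l hl; simp only [mem_fixed, map_mul] at *; rw [hl, T.σ_u]
  · intro l _; field_simp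
  · intro l _; field_simp
  · intro l _
    have := T.mul_σ_ne_zero hx0
    have := T.two_ne
    congr 1
    field_simp

lemma card_rad_of_orth {b x : F} (hx : x ∈ T.rad b) (hx0 : x ≠ 0)
    (h : T.Orth (1 / (x * T.σ x))) : (T.rad b).card = T.fixed.card ^ 2 := by
  have h1 := T.pencilSum_sq (map_one _) one_ne_zero b
  rw [T.pencilSum_one_of_mem_rad hx hx0, T.fixedSum_of_orth ((T.orth_two_mul_iff _).2 h), mul_pow,
    quadSum_one_sq] at h1
  exact_mod_cast (mul_left_cancel₀ card_field_ne_zero h1).symm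

lemma card_rad_of_not_orth {b x : F} (hx : x ∈ T.rad b) (hx0 : x ≠ 0)
    (h : ¬ T.Orth (1 / (x * T.σ x))) : (T.rad b).card = T.fixed.card := by
  have h1 := T.pencilSum_sq (map_one _) one_ne_zero b
  rw [T.pencilSum_one_of_mem_rad hx hx0, mul_pow, T.fixedSum_sq (by rwa [orth_two_mul_iff]),
    quadSum_one_sq] at h1
  exact_mod_cast (mul_left_cancel₀ card_field_ne_zero h1).symm

lemma card_fixed_ne_sq : T.fixed.card ≠ T.fixed.card ^ 2 := by
  have := T.one_lt_card_fixed
  intro h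
  nlinarith

lemma one_ne_card_fixed_sq : 1 ≠ T.fixed.card ^ 2 := by
  have := T.one_lt_card_fixed
  intro h
  nlinarith

lemma card_rad_cases (b : F) : (T.rad b).card = 1 ∨ (T.rad b).card = T.fixed.card ∨
    (T.rad b).card = T.fixed.card ^ 2 := by
  by_cases h : (T.rad b).card = 1
  · exact Or.inl h
  · obtain ⟨x, hx, hx0⟩ := T.exists_mem_rad h
    by_cases ho : T.Orth (1 / (x * T.σ x))
    · exact Or.inr (Or.inr (T.card_rad_of_orth hx hx0 ho))
    · exact Or.inr (Or.inl (T.card_rad_of_not_orth hx hx0 ho))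

/-- The values of the sums when the radical is a line over the fixed field. -/
lemma values_of_card_rad_eq {b : F} (h : (T.rad b).card = T.fixed.card) :
    T.pencilSum T.u b = T.pencilSum 1 b ∧ T.pencilSum 1 (-b) = T.quadSum 1 ∧
      T.pencilSum T.u (-b) = -T.quadSum 1 ∧ (T.rad (-b)).card = 1 := by
  obtain ⟨x, hx, hx0⟩ := T.exists_mem_rad (by rw [h]; exact T.one_lt_card_fixed.ne')
  have ho : ¬ T.Orth (1 / (x * T.σ x)) := fun ho =>
    T.card_fixed_ne_sq (h.symm.trans (T.card_rad_of_orth hx hx0 ho))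
  refine ⟨?_, T.formSum_neg_of_mem_rad (map_one _) hx hx0, ?_, T.card_rad_eq_one_of_neg hx hx0⟩
  · rw [T.pencilSum_u_of_mem_rad hx hx0, T.pencilSum_one_of_mem_rad hx hx0,
      T.fixedSum_u_mul (by rwa [orth_two_mul_iff])]
    ring
  · rw [← quadSum_u]; exact T.formSum_neg_of_mem_rad T.σ_u hx hx0

/-- The values of the sums when the radical is a plane over the fixed field. -/
lemma values_of_card_rad_eq_sq {b : F} (h : (T.rad b).card = T.fixed.card ^ 2) :
    T.pencilSum 1 b = T.quadSum 1 * q₀ ∧ T.pencilSum T.u b = -(T.quadSum 1 * q₀) ∧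
      T.pencilSum 1 (-b) = T.quadSum 1 ∧
      T.pencilSum T.u (-b) = -T.quadSum 1 ∧ (T.rad (-b)).card = 1 := by
  obtain ⟨x, hx, hx0⟩ := T.exists_mem_rad (by rw [h]; exact T.one_ne_card_fixed_sq.symm)
  have ho : T.Orth (1 / (2 * (x * T.σ x))) := by
    rw [orth_two_mul_iff]
    by_contra ho
    exact T.card_fixed_ne_sq ((T.card_rad_of_not_orth hx hx0 ho).symm.trans h)
  refine ⟨?_, ?_, T.formSum_neg_of_mem_rad (map_one _) hx hx0, ?_,
    T.card_rad_eq_one_of_neg hx hx0⟩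
  · rw [T.pencilSum_one_of_mem_rad hx hx0, T.fixedSum_of_orth ho]
  · rw [T.pencilSum_u_of_mem_rad hx hx0,
      T.fixedSum_of_orth ((T.orth_mul_iff T.σ_u T.u_ne_zero _).2 ho)]
  · rw [← quadSum_u]; exact T.formSum_neg_of_mem_rad T.σ_u hx hx0

/-- The number of parameters `b` for which the radical of the form has `r` elements. -/
def radCount (r : ℕ) : ℕ := (Finset.univ.filter fun b => (T.rad b).card = r).card

lemma radCount_add : T.radCount 1 + T.radCount T.fixed.card + T.radCount (T.fixed.card ^ 2) =
    Fintype.card F := by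
  have h1 := T.one_lt_card_fixed
  have h2 := T.card_fixed_ne_sq
  have h3 := T.one_ne_card_fixed_sq
  unfold radCount
  rw [← Finset.card_univ, Finset.card_eq_sum_ones Finset.univ]
  simp only [Finset.card_filter]
  rw [← Finset.sum_add_distrib, ← Finset.sum_add_distrib]
  refine Finset.sum_congr rfl fun b _ => ?_
  rcases T.card_rad_cases b with h | h | h
  · rw [h, if_pos rfl, if_neg h1.ne, if_neg h3]
  · rw [h, if_pos rfl, if_neg h1.ne', if_neg h2]
  · rw [h, if_pos rfl, if_neg h3.symm, if_neg h2.symm]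

lemma sum_card_rad : ∑ b, (T.rad b).card + 1 = 2 * Fintype.card F := by
  have h1 : ∑ b, (T.rad b).card = ∑ z : F, (Finset.univ.filter fun b => z ∈ T.rad b).card := by
    simp_rw [Finset.card_filter]
    rw [Finset.sum_comm]
    refine Finset.sum_congr rfl fun b _ => ?_
    rw [← Finset.card_filter]
    congr 1; ext; simp
  have h2 : ∀ z : F, (Finset.univ.filter fun b => z ∈ T.rad b).card + (if z = 0 then 1 else 0) =
      1 + (if z = 0 then Fintype.card F else 0) := by
    intro z
    split_ifs with hz
    · subst hz
      rw [Finset.filter_true_of_mem fun b _ => T.zero_mem_rad b, Finset.card_univ, add_comm]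
    · rw [add_zero, add_zero, Finset.card_eq_one]
      have := T.two_ne
      refine ⟨-(T.σ z + T.σ.symm z) / (2 * z), ?_⟩
      ext b
      simp only [mem_rad, Finset.mem_filter, Finset.mem_univ, true_and, Finset.mem_singleton]
      rw [eq_div_iff (mul_ne_zero this hz)]
      constructor <;> intro h <;> linear_combination h
  have h3 := Fintype.sum_congr _ _ h2
  rw [Finset.sum_add_distrib, Finset.sum_add_distrib, ← h1] at h3
  simp at h3
  omega

lemma sum_rad_count : T.radCount 1 + T.radCount T.fixed.card * T.fixed.card +
    T.radCount (T.fixed.card ^ 2) * T.fixed.card ^ 2 = ∑ b, (T.rad b).card := by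
  have h1 := T.one_lt_card_fixed
  have h2 := T.card_fixed_ne_sq
  have h3 := T.one_ne_card_fixed_sq
  unfold radCount
  simp only [Finset.card_filter]
  rw [Finset.sum_mul, Finset.sum_mul, ← Finset.sum_add_distrib, ← Finset.sum_add_distrib]
  refine Finset.sum_congr rfl fun b _ => ?_
  rcases T.card_rad_cases b with h | h | h
  · rw [h, if_pos rfl, if_neg h1.ne, if_neg h3]; ring
  · rw [h, if_pos rfl, if_neg h1.ne', if_neg h2]; ring
  · rw [h, if_pos rfl, if_neg h3.symm, if_neg h2.symm]; ring

open Classical in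
/-- The number of `x` for which `x σ(x)` has trace zero in the fixed field; because
`x σ(x) = τ(x)²`, it is the same as for `x²`. -/
lemma card_orth_mul_fixed :
    (Finset.univ.filter fun x => T.Orth (x * T.σ x)).card * T.fixed.card = Fintype.card F := by
  have h1 : ((Finset.univ.filter fun x => T.Orth (x * T.σ x)).card : ℂ) * q₀ =
      ∑ x, ∑ l ∈ T.fixed, T.ψ (l * (x * T.σ x)) := by
    simp_rw [T.sum_fixed_ψ]
    rw [← Finset.sum_filter, Finset.sum_const, nsmul_eq_mul]
  have h2 : ∀ l, ∑ x, T.ψ (l * (x * T.σ x)) = T.quadSum l := by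
    intro l
    rw [← formSum_zero_right]; simp [formSum]
  rw [Finset.sum_comm] at h1
  simp_rw [h2] at h1
  have h3 : ∑ l ∈ T.fixed, T.quadSum l = q := by
    have h4 := T.sum_fixed_sq fun l => T.quadSum l
    have h5 : ∀ l ∈ T.fixed, T.quadSum (l ^ 2) + T.quadSum (T.u * l ^ 2) =
        if l = 0 then 2 * q else 0 := by
      intro l _
      split_ifs with hl
      · subst hl; simp [quadSum]; ring
      · rw [T.quadSum_u_mul (pow_ne_zero 2 hl), add_neg_cancel]
    rw [← Finset.sum_add_distrib, Finset.sum_congr rfl h5, Finset.sum_ite_eq',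
      if_pos (by simp), nsmul_eq_mul] at h4
    exact (mul_left_cancel₀ two_ne_zero h4).symm
  rw [h3] at h1
  exact_mod_cast h1

/-- Double counting of the pairs `(b, x)` with `x ≠ 0` in a radical that is a plane. -/
lemma radCount_sq_mul : (T.radCount (T.fixed.card ^ 2) * (T.fixed.card ^ 2 - 1) + 1) * T.fixed.card
    = Fintype.card F := by
  classical
  rw [← T.card_orth_mul_fixed]
  congr 1
  set X : Finset F := Finset.univ.filter fun x => x ≠ 0 ∧ T.Orth (1 / (x * T.σ x)) with hX
  have e1 : (Finset.univ.filter fun x => T.Orth (x * T.σ x)).card = X.card + 1 := by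
    have : (Finset.univ.filter fun x => T.Orth (x * T.σ x)) = insert 0 (X.image fun x => x⁻¹) := by
      ext x
      simp only [hX, Finset.mem_filter, Finset.mem_univ, true_and, Finset.mem_insert,
        Finset.mem_image]
      constructor
      · intro h
        by_cases hx : x = 0
        · exact Or.inl hx
        · refine Or.inr ⟨x⁻¹, ⟨inv_ne_zero hx, ?_⟩, inv_inv x⟩
          rw [map_inv₀, ← mul_inv, one_div, inv_inv]; exact h
      · rintro (rfl | ⟨y, ⟨_, hy⟩, rfl⟩)
        · intro l _; simp
        · rw [map_inv₀, ← mul_inv, ← one_div]; exact hy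
    rw [this, Finset.card_insert_of_notMem, Finset.card_image_of_injective _ inv_injective]
    simp [hX]
  rw [e1]
  congr 1
  -- `X` is fibred over the parameters `b` by `x ↦ -(σ x + σ⁻¹ x) / (2 x)`
  have h2 := T.two_ne
  have hb : ∀ x b : F, x ≠ 0 → (-(T.σ x + T.σ.symm x) / (2 * x) = b ↔ x ∈ T.rad b) := by
    intro x b hx
    rw [mem_rad, div_eq_iff (mul_ne_zero h2 hx)]
    constructor <;> intro h <;> linear_combination -h
  have hmaps : ∀ x ∈ X, -(T.σ x + T.σ.symm x) / (2 * x) ∈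
      Finset.univ.filter fun b => (T.rad b).card = T.fixed.card ^ 2 := by
    intro x hx
    simp only [hX, Finset.mem_filter, Finset.mem_univ, true_and] at hx ⊢
    exact T.card_rad_of_orth ((hb x _ hx.1).1 rfl) hx.1 hx.2
  rw [Finset.card_eq_sum_card_fiberwise (s := X) hmaps, radCount, ← smul_eq_mul,
    ← Finset.sum_const]
  refine Finset.sum_congr rfl fun b hbm => ?_
  rw [Finset.mem_filter] at hbm
  rw [← hbm.2, ← Finset.card_erase_of_mem (T.zero_mem_rad b)]
  congr 1
  ext x
  simp only [hX, Finset.mem_filter, Finset.mem_univ, true_and, Finset.mem_erase]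
  constructor
  · rintro ⟨hx0, hx⟩
    refine ⟨⟨hx0, ?_⟩, (hb x b hx0).2 hx⟩
    by_contra ho
    exact T.card_fixed_ne_sq ((T.card_rad_of_not_orth hx hx0 ho).symm.trans hbm.2)
  · rintro ⟨⟨hx0, _⟩, hx⟩
    exact ⟨hx0, (hb x b hx0).1 hx⟩

lemma radCount_sq_eq :
    (T.radCount (T.fixed.card ^ 2) : ℂ) * (q₀ ^ 2 - 1) * q₀ = q - q₀ := by
  have h := T.radCount_sq_mul
  have h1 : 1 ≤ T.fixed.card ^ 2 := Nat.one_le_pow _ _ (by have := T.one_lt_card_fixed; omega)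
  have h' : (((T.radCount (T.fixed.card ^ 2) * (T.fixed.card ^ 2 - 1) + 1) * T.fixed.card : ℕ) : ℂ)
    = q := by rw [h]
  push_cast [Nat.cast_sub h1] at h'
  linear_combination h'

lemma radCount_eq : (T.radCount T.fixed.card : ℂ) * q₀ = q := by
  have h1 : ((T.radCount 1 + T.radCount T.fixed.card + T.radCount (T.fixed.card ^ 2) : ℕ) : ℂ) =
      q := by rw [T.radCount_add]
  have h2 : ((∑ b, (T.rad b).card + 1 : ℕ) : ℂ) = 2 * q := by rw [T.sum_card_rad]; push_cast; ring
  rw [← T.sum_rad_count] at h2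
  have h3 := T.radCount_sq_eq
  push_cast at h1 h2
  have h4 : q₀ - 1 ≠ 0 := sub_ne_zero.2 T.card_fixed_ne_one
  refine mul_left_cancel₀ h4 ?_
  linear_combination q₀ * h2 - q₀ * h1 - h3

/-! ### Moments -/

lemma sum_pencilSum {s : F} (hs : s ≠ 0) : ∑ b, T.pencilSum s b = q := by
  unfold pencilSum formSum
  rw [Finset.sum_comm, Finset.sum_eq_single_of_mem 0 (Finset.mem_univ _)]
  · simp
  · intro x _ hx
    have : ∀ b, T.ψ (s * (x * T.σ x) + s * b * x ^ 2) =
        T.ψ (s * (x * T.σ x)) * T.ψ (b * (s * x ^ 2)) := fun b => by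
      rw [← AddChar.map_add_eq_mul]; congr 1; ring
    simp_rw [this]
    rw [← Finset.mul_sum, T.sum_ψ_mul, if_neg (mul_ne_zero hs (pow_ne_zero 2 hx)), mul_zero]

/-- Mixed second moment: only the trivial zero of the anisotropic form `x² + c y²` contributes. -/
lemma sum_formSum_mul_formSum {c : F} (hc : ¬ IsSquare (-c)) :
    ∑ b, T.formSum 1 b * T.formSum T.u (c * b) = q := by
  have h1 : ∀ b, T.formSum 1 b * T.formSum T.u (c * b) = ∑ x, ∑ y,
      T.ψ (x * T.σ x + T.u * (y * T.σ y)) * T.ψ (b * (x ^ 2 + c * y ^ 2)) := by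
    intro b
    unfold formSum
    rw [Finset.sum_mul_sum]
    refine Finset.sum_congr rfl fun x _ => Finset.sum_congr rfl fun y _ => ?_
    rw [← AddChar.map_add_eq_mul, ← AddChar.map_add_eq_mul]
    congr 1; ring
  simp_rw [h1]
  rw [Finset.sum_comm]
  simp_rw [Finset.sum_comm (γ := F) (s := Finset.univ) (t := Finset.univ) (f := fun b y =>
    T.ψ (_ * T.σ _ + T.u * (y * T.σ y)) * T.ψ (b * (_ ^ 2 + c * y ^ 2))),
    ← Finset.mul_sum, T.sum_ψ_mul]
  have h0 : ∀ x y : F, x ^ 2 + c * y ^ 2 = 0 → y = 0 := by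
    intro x y h
    by_contra hy
    exact hc ⟨x / y, by field_simp; linear_combination -h⟩
  rw [Finset.sum_eq_single_of_mem 0 (Finset.mem_univ _),
    Finset.sum_eq_single_of_mem 0 (Finset.mem_univ _)]
  · simp
  · intro y _ hy
    rw [if_neg (fun h => hy (h0 _ _ h)), mul_zero]
  · intro x _ hx
    refine Finset.sum_eq_zero fun y _ => ?_
    rw [if_neg, mul_zero]
    intro h
    have hy := h0 _ _ h
    subst hy
    simp [hx] at h

lemma not_isSquare_neg_u : ¬ IsSquare (-T.u) := by
  rintro ⟨z, hz⟩
  obtain ⟨i, hi⟩ := T.isSquare_neg_one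
  exact T.not_isSquare_u ⟨i * z, by linear_combination -hz + z ^ 2 * hi⟩

lemma sum_pencilSum_mul : ∑ b, T.pencilSum 1 b * T.pencilSum T.u b = q := by
  rw [← T.sum_formSum_mul_formSum T.not_isSquare_neg_u]
  simp [pencilSum]

lemma sum_pencilSum_mul_neg : ∑ b, T.pencilSum 1 b * T.pencilSum T.u (-b) = q := by
  rw [← T.sum_formSum_mul_formSum (c := -T.u) (by rw [neg_neg]; exact T.not_isSquare_u)]
  simp [pencilSum]

/-- For a nondegenerate form, multiplication by the nonsquare `u` changes the sign of the sum:
otherwise the mixed second moment would be too large. -/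
lemma pencilSum_u_of_card_rad_eq_one {b : F} (h : (T.rad b).card = 1) :
    T.pencilSum T.u b = -T.pencilSum 1 b := by
  classical
  have hq : q ≠ 0 := card_field_ne_zero
  have n1 := T.one_lt_card_fixed
  have n2 := T.card_fixed_ne_sq
  have n3 := T.one_ne_card_fixed_sq
  set Y : Finset F := Finset.univ.filter fun b =>
    (T.rad b).card = 1 ∧ T.pencilSum T.u b ≠ -T.pencilSum 1 b with hY
  have key : ∀ b, T.pencilSum 1 b * T.pencilSum T.u b =
      (if (T.rad b).card = T.fixed.card then q * q₀ else 0) +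
      (if (T.rad b).card = T.fixed.card ^ 2 then -(q * q₀ ^ 2) else 0) +
      (if (T.rad b).card = 1 then -q else 0) +
      (if (T.rad b).card = 1 ∧ T.pencilSum T.u b ≠ -T.pencilSum 1 b then 2 * q else 0) := by
    intro b
    have s1 := T.pencilSum_sq (map_one _) one_ne_zero b
    have s2 := T.pencilSum_sq T.σ_u T.u_ne_zero b
    rcases T.card_rad_cases b with h | h | h
    · simp only [h, n1.ne, n3, if_false, if_true, true_and, zero_add]
      rw [h] at s1 s2
      split_ifs with h'
      · have : T.pencilSum T.u b = T.pencilSum 1 b := by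
          have : T.pencilSum T.u b ^ 2 = T.pencilSum 1 b ^ 2 := by rw [s1, s2]
          rw [sq_eq_sq_iff_eq_or_eq_neg] at this
          exact this.resolve_right h'
        rw [this]; push_cast at s1; linear_combination s1
      · push Not at h'
        rw [h']; push_cast at s1; linear_combination -s1
    · simp only [h, n1.ne', n2, if_false, if_true, false_and, add_zero]
      rw [(T.values_of_card_rad_eq h).1, ← sq, s1, h]
    · simp only [h, n2.symm, n3.symm, if_false, if_true, false_and, add_zero, zero_add]
      have hv := T.values_of_card_rad_eq_sq h
      rw [hv.1, hv.2.1]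
      linear_combination -q₀ ^ 2 * T.quadSum_one_sq
  have hsum := T.sum_pencilSum_mul
  simp_rw [key] at hsum
  simp only [Finset.sum_add_distrib, ← Finset.sum_filter, Finset.sum_const, nsmul_eq_mul] at hsum
  have c1 := T.radCount_sq_eq
  have c2 := T.radCount_eq
  have c3 : ((T.radCount 1 + T.radCount T.fixed.card + T.radCount (T.fixed.card ^ 2) : ℕ) : ℂ) =
      q := by rw [T.radCount_add]
  push_cast at c3
  have hY0 : (Y.card : ℂ) = 0 := by
    change (T.radCount _ : ℂ) * _ + (T.radCount _ : ℂ) * _ + (T.radCount _ : ℂ) * _ +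
      (Y.card : ℂ) * _ = _ at hsum
    have h4 : (2 * q * q₀) * (Y.card : ℂ) = 0 := by
      linear_combination q₀ * hsum + q * c1 + q * q₀ * c3 - q * (q₀ + 1) * c2
    simpa [T.card_fixed_ne_zero, hq] using h4
  have hYe : Y = ∅ := Finset.card_eq_zero.1 (by exact_mod_cast hY0)
  by_contra hne
  have : b ∈ Y := by simp [hY, h, hne]
  simp [hYe] at this
/-! ### Classes of parameters and their sizes -/

/-- The number of parameters whose form has a one-dimensional radical and exponential sum `v`. -/
noncomputable def lineCount (v : ℂ) : ℕ :=
  (Finset.univ.filter fun b => (T.rad b).card = T.fixed.card ∧ T.pencilSum 1 b = v).card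

/-- The number of parameters `b` such that `b` and `-b` are nondegenerate with equal sums. -/
noncomputable def eqCount : ℕ :=
  (Finset.univ.filter fun b => ((T.rad b).card = 1 ∧ (T.rad (-b)).card = 1) ∧
    T.pencilSum 1 b = T.pencilSum 1 (-b)).card

/-- The number of parameters `b` such that `b` and `-b` are nondegenerate with different sums. -/
noncomputable def neCount : ℕ :=
  (Finset.univ.filter fun b => ((T.rad b).card = 1 ∧ (T.rad (-b)).card = 1) ∧
    T.pencilSum 1 b ≠ T.pencilSum 1 (-b)).card

lemma card_filter_neg (p : F → Prop) [DecidablePred p] :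
    (Finset.univ.filter fun b => p (-b)).card = (Finset.univ.filter p).card :=
  Finset.card_equiv (Equiv.neg F) (by simp)

lemma sum_ite_const (p : F → Prop) [DecidablePred p] (v : ℂ) :
    ∑ b, (if p b then v else 0) = ((Finset.univ.filter p).card : ℂ) * v := by
  rw [← Finset.sum_filter, Finset.sum_const, nsmul_eq_mul]

section classes

variable {T} {g g₀ : ℂ}

lemma quadSum_one_cases (hg : g ^ 2 = q) : T.quadSum 1 = g ∨ T.quadSum 1 = -g := by
  rw [← sq_eq_sq_iff_eq_or_eq_neg, T.quadSum_one_sq, hg]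

lemma pencilSum_cases_of_card_rad_eq (hg : g ^ 2 = q) (hg₀ : g₀ ^ 2 = q₀) {b : F}
    (h : (T.rad b).card = T.fixed.card) :
    T.pencilSum 1 b = g * g₀ ∨ T.pencilSum 1 b = -(g * g₀) := by
  rw [← sq_eq_sq_iff_eq_or_eq_neg, T.pencilSum_sq (map_one _) one_ne_zero, h, mul_pow, hg, hg₀]

lemma pencilSum_cases_of_card_rad_eq_one (hg : g ^ 2 = q) {b : F} (h : (T.rad b).card = 1) :
    T.pencilSum 1 b = g ∨ T.pencilSum 1 b = -g := by
  rw [← sq_eq_sq_iff_eq_or_eq_neg, T.pencilSum_sq (map_one _) one_ne_zero, h, hg]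
  simp

lemma root_mul_ne_neg (hg : g ^ 2 = q) (hg₀ : g₀ ^ 2 = q₀) : g * g₀ ≠ -(g * g₀) := by
  intro h
  have h1 : 4 * (q * q₀) = 0 := by
    rw [← hg, ← hg₀]; linear_combination (2 * g * g₀) * h
  simp [T.card_fixed_ne_zero] at h1

/-- A function of the sums at `b` and `-b` that takes one value on each class of parameters is
summed by counting the classes. -/
lemma sum_classes (hg : g ^ 2 = q) (hg₀ : g₀ ^ 2 = q₀) (h : ℂ → ℂ → ℂ → ℂ → ℂ)
    {vp vm v₂ vd ve : ℂ}
    (hp : ∀ a, a = g ∨ a = -g → h (g * g₀) (g * g₀) a (-a) = vp ∧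
      h a (-a) (g * g₀) (g * g₀) = vp)
    (hm : ∀ a, a = g ∨ a = -g → h (-(g * g₀)) (-(g * g₀)) a (-a) = vm ∧
      h a (-a) (-(g * g₀)) (-(g * g₀)) = vm)
    (h₂ : ∀ a, a = g ∨ a = -g → h (a * q₀) (-(a * q₀)) a (-a) = v₂ ∧
      h a (-a) (a * q₀) (-(a * q₀)) = v₂)
    (hd : ∀ a, a = g ∨ a = -g → h a (-a) (-a) a = vd)
    (he : ∀ a, a = g ∨ a = -g → h a (-a) a (-a) = ve) :
    ∑ b, h (T.pencilSum 1 b) (T.pencilSum T.u b) (T.pencilSum 1 (-b)) (T.pencilSum T.u (-b)) =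
      2 * T.lineCount (g * g₀) * vp + 2 * T.lineCount (-(g * g₀)) * vm +
      2 * T.radCount (T.fixed.card ^ 2) * v₂ + T.neCount * vd + T.eqCount * ve := by
  classical
  have n1 := T.one_lt_card_fixed
  have n2 := T.card_fixed_ne_sq
  have n3 := T.one_ne_card_fixed_sq
  have hG := quadSum_one_cases (T := T) hg
  have hgg := root_mul_ne_neg (T := T) hg hg₀
  have key : ∀ b, h (T.pencilSum 1 b) (T.pencilSum T.u b) (T.pencilSum 1 (-b))
      (T.pencilSum T.u (-b)) =
      (if (T.rad b).card = T.fixed.card ∧ T.pencilSum 1 b = g * g₀ then vp else 0) +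
      (if (T.rad (-b)).card = T.fixed.card ∧ T.pencilSum 1 (-b) = g * g₀ then vp else 0) +
      (if (T.rad b).card = T.fixed.card ∧ T.pencilSum 1 b = -(g * g₀) then vm else 0) +
      (if (T.rad (-b)).card = T.fixed.card ∧ T.pencilSum 1 (-b) = -(g * g₀) then vm else 0) +
      (if (T.rad b).card = T.fixed.card ^ 2 then v₂ else 0) +
      (if (T.rad (-b)).card = T.fixed.card ^ 2 then v₂ else 0) +
      (if ((T.rad b).card = 1 ∧ (T.rad (-b)).card = 1) ∧
        T.pencilSum 1 b ≠ T.pencilSum 1 (-b) then vd else 0) +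
      (if ((T.rad b).card = 1 ∧ (T.rad (-b)).card = 1) ∧
        T.pencilSum 1 b = T.pencilSum 1 (-b) then ve else 0) := by
    intro b
    rcases T.card_rad_cases b with h1 | h1 | h1
    · rcases T.card_rad_cases (-b) with h2 | h2 | h2
      · simp only [h1, h2, n1.ne, n3, and_true, if_false, false_and, true_and, zero_add]
        rw [T.pencilSum_u_of_card_rad_eq_one h1, T.pencilSum_u_of_card_rad_eq_one h2]
        by_cases hab : T.pencilSum 1 b = T.pencilSum 1 (-b)
        · rw [if_neg (not_not.2 hab), if_pos hab, ← hab,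
            he _ (pencilSum_cases_of_card_rad_eq_one hg h1), zero_add]
        · have hab' : T.pencilSum 1 (-b) = -T.pencilSum 1 b := by
            have : T.pencilSum 1 (-b) ^ 2 = T.pencilSum 1 b ^ 2 := by
              rw [T.pencilSum_sq (map_one _) one_ne_zero, T.pencilSum_sq (map_one _) one_ne_zero,
                h1, h2]
            rw [sq_eq_sq_iff_eq_or_eq_neg] at this
            exact this.resolve_left (Ne.symm hab)
          rw [if_pos hab, if_neg hab, hab', neg_neg,
            hd _ (pencilSum_cases_of_card_rad_eq_one hg h1), add_zero]
      · obtain ⟨w1, w2, w3, -⟩ := T.values_of_card_rad_eq h2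
        rw [neg_neg] at w2 w3
        simp only [h1, h2, n1.ne, n1.ne', n2, n3, w1, w2, w3, and_false, if_false, false_and,
          true_and, zero_add, add_zero]
        rcases pencilSum_cases_of_card_rad_eq hg hg₀ h2 with w | w
        · rw [w, if_pos rfl, if_neg hgg, (hp _ hG).2, add_zero]
        · rw [w, if_pos rfl, if_neg hgg.symm, (hm _ hG).2, zero_add]
      · obtain ⟨w1, w2, w3, w4, -⟩ := T.values_of_card_rad_eq_sq h2
        rw [neg_neg] at w3 w4
        simp only [h1, h2, n1.ne, n2.symm, n3, n3.symm, w1, w2, w3, w4, and_false, if_false,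
          false_and, zero_add, add_zero, if_true]
        exact (h₂ _ hG).2
    · obtain ⟨w1, w2, w3, h2⟩ := T.values_of_card_rad_eq h1
      simp only [h1, h2, n1.ne, n1.ne', n2, n3, w1, w2, w3, if_false, false_and,
        true_and, add_zero]
      rcases pencilSum_cases_of_card_rad_eq hg hg₀ h1 with w | w
      · rw [w, if_pos rfl, if_neg hgg, (hp _ hG).1, add_zero]
      · rw [w, if_pos rfl, if_neg hgg.symm, (hm _ hG).1, zero_add]
    · obtain ⟨w1, w2, w3, w4, h2⟩ := T.values_of_card_rad_eq_sq h1
      simp only [h1, h2, n1.ne, n2.symm, n3, n3.symm, w1, w2, w3, w4, if_false,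
        false_and, zero_add, add_zero, if_true]
      exact (h₂ _ hG).1
  simp_rw [key, Finset.sum_add_distrib, sum_ite_const]
  rw [card_filter_neg (fun b => (T.rad b).card = T.fixed.card ∧ T.pencilSum 1 b = g * g₀),
    card_filter_neg (fun b => (T.rad b).card = T.fixed.card ∧ T.pencilSum 1 b = -(g * g₀)),
    card_filter_neg (fun b => (T.rad b).card = T.fixed.card ^ 2)]
  unfold lineCount radCount neCount eqCount
  ring

lemma lineCount_add (hg : g ^ 2 = q) (hg₀ : g₀ ^ 2 = q₀) :
    T.lineCount (g * g₀) + T.lineCount (-(g * g₀)) = T.radCount T.fixed.card := by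
  classical
  unfold lineCount radCount
  rw [← Finset.card_union_of_disjoint]
  · congr 1
    ext b
    simp only [Finset.mem_union, Finset.mem_filter, Finset.mem_univ, true_and, ← and_or_left]
    exact ⟨fun h => h.1, fun h => ⟨h, pencilSum_cases_of_card_rad_eq hg hg₀ h⟩⟩
  · refine Finset.disjoint_filter.2 fun b _ h1 h2 => ?_
    exact root_mul_ne_neg (T := T) hg hg₀ (h1.2.symm.trans h2.2)

lemma sum_neg (f : F → ℂ) : ∑ b, f (-b) = ∑ b, f b :=
  Fintype.sum_equiv (Equiv.neg F) _ _ fun _ => rfl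

/-- The sizes of the classes, from the count of degenerate forms and three moments. -/
lemma class_sizes (hg : g ^ 2 = q) (hg₀ : g₀ ^ 2 = q₀) :
    (T.radCount (T.fixed.card ^ 2) : ℂ) = (q / q₀ - 1) / (q₀ ^ 2 - 1) ∧
    (T.lineCount (g * g₀) : ℂ) = 1 / 2 * (g / g₀) * (g / g₀ + 1) ∧
    (T.lineCount (-(g * g₀)) : ℂ) = 1 / 2 * (g / g₀) * (g / g₀ - 1) ∧
    (T.neCount : ℂ) = 1 / 2 * (q₀ - 1) * (q + 1) / (q₀ + 1) ∧
    (T.eqCount : ℂ) + 1 = 1 / 2 * (q * q₀ - 3 * q + q₀ + 1) / (q₀ - 1) := by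
  have z0 := T.card_fixed_ne_zero
  have z1 : q₀ - 1 ≠ 0 := sub_ne_zero.2 T.card_fixed_ne_one
  have z2 : q₀ + 1 ≠ 0 := by exact_mod_cast Nat.succ_ne_zero T.fixed.card
  have z3 : q₀ ^ 2 - 1 ≠ 0 := by
    rw [show q₀ ^ 2 - 1 = (q₀ - 1) * (q₀ + 1) by ring]; exact mul_ne_zero z1 z2
  have zq : q ≠ 0 := card_field_ne_zero
  have zg : g ≠ 0 := by rintro rfl; exact zq (by rw [← hg]; ring)
  have zg0 : g₀ ≠ 0 := by rintro rfl; exact z0 (by rw [← hg₀]; ring)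
  have c1 := T.radCount_sq_eq
  have c2 : (T.lineCount (g * g₀) + T.lineCount (-(g * g₀)) : ℂ) * q₀ = q := by
    rw [← T.radCount_eq, ← lineCount_add hg hg₀]; push_cast; ring
  have sg : ∀ a : ℂ, a = g ∨ a = -g → a ^ 2 = q := by
    rintro a (rfl | rfl)
    · exact hg
    · rw [neg_sq, hg]
  have m0 := sum_classes hg hg₀ (fun _ _ _ _ => 1) (vp := 1) (vm := 1) (v₂ := 1)
    (vd := 1) (ve := 1) (by simp) (by simp) (by simp) (by simp) (by simp)
  have m1 := sum_classes hg hg₀ (fun a b c d => a + b + c + d) (vp := 2 * (g * g₀))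
    (vm := -(2 * (g * g₀))) (v₂ := 0) (vd := 0) (ve := 0)
    (fun a _ => ⟨by ring, by ring⟩) (fun a _ => ⟨by ring, by ring⟩)
    (fun a _ => ⟨by ring, by ring⟩) (fun a _ => by ring) (fun a _ => by ring)
  have m2 := sum_classes hg hg₀ (fun a b c d => a * d + b * c) (vp := 0)
    (vm := 0) (v₂ := -(2 * (q * q₀))) (vd := 2 * q) (ve := -(2 * q))
    (fun a _ => ⟨by ring, by ring⟩) (fun a _ => ⟨by ring, by ring⟩)
    (fun a h => ⟨by linear_combination (-(2 * q₀)) * sg a h,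
      by linear_combination (-(2 * q₀)) * sg a h⟩)
    (fun a h => by linear_combination 2 * sg a h)
    (fun a h => by linear_combination -2 * sg a h)
  have e0 : ∑ _b : F, (1 : ℂ) = q := by simp
  have e2 : ∑ b, T.pencilSum T.u b * T.pencilSum 1 (-b) = q := by
    rw [← T.sum_pencilSum_mul_neg, ← sum_neg]
    exact Finset.sum_congr rfl fun b _ => by rw [neg_neg, mul_comm]
  rw [e0] at m0
  simp only [Finset.sum_add_distrib] at m1 m2
  rw [sum_neg (fun b => T.pencilSum 1 b), sum_neg (fun b => T.pencilSum T.u b),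
    T.sum_pencilSum one_ne_zero, T.sum_pencilSum T.u_ne_zero] at m1
  rw [T.sum_pencilSum_mul_neg, e2] at m2
  rw [← hg₀] at *
  rw [← hg] at *
  generalize (T.lineCount (g * g₀) : ℂ) = np at *
  generalize (T.lineCount (-(g * g₀)) : ℂ) = nm at *
  generalize (T.neCount : ℂ) = nd at *
  generalize (T.eqCount : ℂ) = ne at *
  generalize (T.radCount (T.fixed.card ^ 2) : ℂ) = n2 at *
  have d1 : (np - nm) * g₀ = g := by
    refine mul_left_cancel₀ (mul_ne_zero (by norm_num : (4 : ℂ) ≠ 0) zg) ?_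
    linear_combination -m1
  have r1 : n2 = (g ^ 2 / g₀ ^ 2 - 1) / ((g₀ ^ 2) ^ 2 - 1) := by
    rw [eq_div_iff z3]; field_simp; linear_combination c1
  have d2 : nd - ne = 1 + 2 * g₀ ^ 2 * n2 := by
    refine mul_left_cancel₀ (mul_ne_zero two_ne_zero (pow_ne_zero 2 zg)) ?_
    linear_combination -m2
  refine ⟨r1, ?_, ?_, ?_, ?_⟩
  · field_simp; linear_combination c2 + g₀ * d1
  · field_simp; linear_combination c2 - g₀ * d1
  · rw [eq_div_iff z2]
    refine mul_left_cancel₀ (mul_ne_zero two_ne_zero z0) ?_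
    linear_combination g₀ ^ 2 * (g₀ ^ 2 + 1) * (d2 - m0) + 2 * c1 - 2 * (g₀ ^ 2 + 1) * c2
  · rw [eq_div_iff z1]
    refine mul_left_cancel₀ (mul_ne_zero two_ne_zero z0) ?_
    linear_combination -g₀ ^ 2 * (g₀ ^ 2 - 1) * (d2 + m0) - 2 * c1 - 2 * (g₀ ^ 2 - 1) * c2

/-- The distribution of the sum of a form and its companion, tested against an arbitrary
function `φ`. -/
theorem sum_distribution (hg : g ^ 2 = q) (hg₀ : g₀ ^ 2 = q₀) (φ : ℂ → ℂ) :
    ∑ α, ∑ β, φ (T.formSum α β + T.formSum (T.u * α) (-(T.u * β))) =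
      φ (2 * q) + (q - 1) *
        ((q / q₀ - 1) / (q₀ ^ 2 - 1) * (φ (g * q₀ - g) + φ (-(g * q₀ - g))) +
        1 / 2 * (g / g₀) * (g / g₀ + 1) * (φ (g * g₀ - g) + φ (g * g₀ + g)) +
        1 / 2 * (g / g₀) * (g / g₀ - 1) * (φ (-(g * g₀ - g)) + φ (-(g * g₀ + g))) +
        1 / 4 * (q₀ - 1) * (q + 1) / (q₀ + 1) * (φ (2 * g) + φ (-(2 * g))) +
        1 / 2 * (q * q₀ - 3 * q + q₀ + 1) / (q₀ - 1) * φ 0) := by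
  classical
  set H : F → ℂ := fun α => ∑ β, φ (T.formSum α β + T.formSum (T.u * α) (-(T.u * β))) with hH
  have hzero : H 0 = φ (2 * q) + (q - 1) * φ 0 := by
    simp only [hH, mul_zero]
    rw [← Finset.add_sum_erase _ _ (Finset.mem_univ (0 : F)),
      Finset.sum_congr rfl (g := fun _ => φ 0)]
    · have : T.formSum 0 0 = q := by simp [formSum]
      rw [mul_zero, neg_zero, this, Finset.sum_const, Finset.card_erase_of_mem (Finset.mem_univ _),
        Finset.card_univ, nsmul_eq_mul, Nat.cast_sub Fintype.card_pos, two_mul, Nat.cast_one]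
    · intro β hβ
      rw [formSum_zero_left, formSum_zero_left, quadSum_neg,
        T.quadSum_u_mul (Finset.ne_of_mem_erase hβ),
        add_neg_cancel]
  have hreindex : ∀ {s c : F}, s ≠ 0 → c ≠ 0 → ∀ f : F → ℂ, ∑ β, f β = ∑ b, f (s * b * c ^ 2) := by
    intro s c hs hc f
    refine (Fintype.sum_equiv (Equiv.mulLeft₀ (s * c ^ 2) (mul_ne_zero hs (pow_ne_zero 2 hc)))
      _ _ fun b => ?_).symm
    simp only [Equiv.mulLeft₀_apply]
    congr 1; ring
  have hpair : ∀ x : F, x ≠ 0 → H (x ^ 2) + H (T.u * x ^ 2) =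
      ∑ b, (φ (T.pencilSum 1 b + T.pencilSum T.u (-b)) +
        φ (T.pencilSum T.u b + T.pencilSum 1 (-b))) := by
    intro x hx
    obtain ⟨c, hc⟩ := T.τ_bijective.2 x
    have hc' := T.mul_σ c
    rw [hc] at hc'
    have hc0 : c ≠ 0 := by
      rintro rfl
      simp at hc'
      exact pow_ne_zero 2 hx hc'.symm
    rw [Finset.sum_add_distrib, ← hc']
    simp only [hH]
    congr 1
    · rw [hreindex one_ne_zero hc0]
      refine Finset.sum_congr rfl fun b _ => ?_
      unfold pencilSum
      rw [← T.formSum_scale hc0 1 (1 * b), ← T.formSum_scale hc0 T.u (T.u * -b)]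
      congr 3 <;> ring
    · rw [hreindex T.u_ne_zero hc0]
      refine Finset.sum_congr rfl fun b _ => ?_
      unfold pencilSum
      rw [← T.formSum_scale hc0 T.u (T.u * b), ← T.formSum_fixed_scale T.σ_u T.u_ne_zero 1 (1 * -b),
        ← T.formSum_scale hc0 (T.u ^ 2 * 1)]
      congr 3 <;> ring
  have hclasses := sum_classes hg hg₀ (fun a b c d => φ (a + d) + φ (b + c))
    (vp := φ (g * g₀ - g) + φ (g * g₀ + g)) (vm := φ (-(g * g₀ - g)) + φ (-(g * g₀ + g)))
    (v₂ := φ (g * q₀ - g) + φ (-(g * q₀ - g))) (vd := φ (2 * g) + φ (-(2 * g))) (ve := φ 0 + φ 0)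
    (by rintro a (rfl | rfl) <;> constructor <;> ring_nf)
    (by rintro a (rfl | rfl) <;> constructor <;> ring_nf)
    (by rintro a (rfl | rfl) <;> constructor <;> ring_nf)
    (by rintro a (rfl | rfl) <;> ring_nf)
    (by rintro a (rfl | rfl) <;> ring_nf)
  have hsplit := T.sum_univ_sq fun α => if α = 0 then 0 else H α
  have hu := T.u_ne_zero
  have hx : ∀ x : F, ((if x ^ 2 = 0 then 0 else H (x ^ 2)) +
      if T.u * x ^ 2 = 0 then 0 else H (T.u * x ^ 2)) = if x = 0 then 0 else
      ∑ b, (φ (T.pencilSum 1 b + T.pencilSum T.u (-b)) +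
        φ (T.pencilSum T.u b + T.pencilSum 1 (-b))) := by
    intro x
    by_cases hx0 : x = 0
    · simp [hx0]
    · rw [if_neg (pow_ne_zero 2 hx0), if_neg (mul_ne_zero hu (pow_ne_zero 2 hx0)), if_neg hx0,
        hpair x hx0]
  have hne : ∀ c : ℂ, ∑ x : F, (if x = 0 then 0 else c) = (q - 1) * c := by
    intro c
    rw [← Finset.add_sum_erase _ _ (Finset.mem_univ (0 : F)), if_pos rfl, zero_add,
      Finset.sum_congr rfl fun x hx => if_neg (Finset.ne_of_mem_erase hx), Finset.sum_const,
      Finset.card_erase_of_mem (Finset.mem_univ _), Finset.card_univ, nsmul_eq_mul,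
      Nat.cast_sub Fintype.card_pos, Nat.cast_one]
  rw [← Finset.sum_add_distrib, Fintype.sum_congr _ _ hx, hne, hclasses, two_nsmul] at hsplit
  have htotal : ∑ α, H α = H 0 + ∑ α, if α = 0 then 0 else H α := by
    rw [← Finset.add_sum_erase _ H (Finset.mem_univ (0 : F)),
      ← Finset.add_sum_erase _ (fun α => if α = 0 then 0 else H α) (Finset.mem_univ (0 : F)),
      if_pos rfl, zero_add]
    congr 1
    exact Finset.sum_congr rfl fun x hx => (if_neg (Finset.ne_of_mem_erase hx)).symm
  obtain ⟨s1, s2, s3, s4, s5⟩ := class_sizes (T := T) hg hg₀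
  rw [htotal, hzero]
  rw [← s1, ← s2, ← s3, ← s5,
    show 1 / 4 * (q₀ - 1) * (q + 1) / (q₀ + 1) = 1 / 2 * (T.neCount : ℂ) by
    rw [s4]; ring]
  linear_combination -(1 / 2) * hsplit

end classes

end TwistedSetting

/-! ### The Frobenius setting -/

/-- The arithmetic of the parameters: with `d = gcd m k`, the quotient `m / d` is odd, while `k / d`
and `d` are even. -/
lemma parameters_of_padicValNat_lt {m k : ℕ} (hm : 1 ≤ padicValNat 2 m)
    (hmk : padicValNat 2 m < padicValNat 2 k) :
    ∃ n l, m = m.gcd k * n ∧ k = m.gcd k * l ∧ Odd n ∧ Even l ∧ Even (m.gcd k) := by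
  have hm0 : m ≠ 0 := by rintro rfl; simp at hm
  have hk0 : k ≠ 0 := by rintro rfl; simp at hmk
  obtain ⟨n, hn⟩ := Nat.gcd_dvd_left m k
  obtain ⟨l, hl⟩ := Nat.gcd_dvd_right m k
  have hd0 : 0 < m.gcd k := Nat.gcd_pos_of_pos_left _ (Nat.pos_of_ne_zero hm0)
  set d := m.gcd k with hd
  have hn0 : n ≠ 0 := by rintro rfl; simp at hn; exact hm0 hn
  have hl0 : l ≠ 0 := by rintro rfl; simp at hl; exact hk0 hl
  have vm : padicValNat 2 m = padicValNat 2 d + padicValNat 2 n := by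
    conv_lhs => rw [hn]
    exact padicValNat.mul hd0.ne' hn0
  have vk : padicValNat 2 k = padicValNat 2 d + padicValNat 2 l := by
    conv_lhs => rw [hl]
    exact padicValNat.mul hd0.ne' hl0
  have hl2 : 2 ∣ l := dvd_of_one_le_padicValNat (by omega)
  have hcop : Nat.Coprime n l := by
    have h1 : d * n.gcd l = d * 1 := by
      rw [← Nat.gcd_mul_left, ← hn, ← hl, mul_one]
    exact Nat.eq_of_mul_eq_mul_left hd0 h1
  have hn2 : ¬ 2 ∣ n := fun h => by
    have := Nat.dvd_gcd h hl2
    rw [hcop] at this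
    omega
  have hd2 : 2 ∣ d := by
    have : 2 ∣ m := dvd_of_one_le_padicValNat hm
    rw [hn] at this
    exact (Nat.prime_two.dvd_mul.1 this).resolve_right hn2
  exact ⟨n, l, hn, hl, Nat.not_even_iff_odd.1 fun h => hn2 h.two_dvd,
    (even_iff_two_dvd).2 hl2, (even_iff_two_dvd).2 hd2⟩

/-- Elements of the prime field become squares in a field of even degree over it. -/
lemma isSquare_algebraMap_zmod {p m : ℕ} [Fact p.Prime] (hp : p ≠ 2) (hm : Even m) {F : Type*}
    [Field F] [Finite F] [Algebra (ZMod p) F] (hF : Nat.card F = p ^ m) (y : ZMod p) :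
    IsSquare (algebraMap (ZMod p) F y) := by
  classical
  have := Fintype.ofFinite F
  have hpp : p.Prime := Fact.out
  by_cases hy : y = 0
  · subst hy; exact ⟨0, by simp⟩
  have hchar : CharP F p := charP_of_injective_algebraMap (algebraMap (ZMod p) F).injective p
  have hF2 : ringChar F ≠ 2 := by rwa [ringChar.eq F p]
  rw [FiniteField.isSquare_iff hF2 (by simpa using hy), ← Nat.card_eq_fintype_card, hF]
  obtain ⟨r, rfl⟩ := hm
  have hodd : Odd p := hpp.odd_of_ne_two hp
  have h1 : (p - 1) * 2 ∣ p ^ (r + r) - 1 := by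
    have h2 : p ^ 2 - 1 ∣ p ^ (r + r) - 1 := by
      rw [← two_mul, pow_mul]; exact Nat.sub_one_dvd_pow_sub_one _ _
    refine dvd_trans ?_ h2
    rw [show p ^ 2 - 1 = (p - 1) * (p + 1) by rw [mul_comm, ← Nat.sq_sub_sq p 1, one_pow]]
    exact mul_dvd_mul_left _ hodd.add_one.two_dvd
  obtain ⟨t, ht⟩ := h1
  have h3 : p ^ (r + r) / 2 = (p - 1) * t := by
    have : 0 < p ^ (r + r) := pow_pos hpp.pos _
    have h4 : p ^ (r + r) = 2 * ((p - 1) * t) + 1 := by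
      have : (p - 1) * 2 * t = 2 * ((p - 1) * t) := by ring
      omega
    omega
  rw [h3, ← map_pow, pow_mul, ZMod.pow_card_sub_one_eq_one hy, one_pow, map_one]

section frobenius

set_option linter.unusedSectionVars false

variable {p m k : ℕ} [Fact p.Prime] {F : Type*} [Field F] [Finite F] [Algebra (ZMod p) F]

lemma pow_pow_mul_of_eq_neg {x : F} (hp : p ≠ 2) (h : x ^ p ^ k = -x) (j : ℕ) :
    x ^ p ^ (k * j) = (-1) ^ j * x := by
  have hpp : p.Prime := Fact.out
  have hodd : Odd (p ^ k) := (hpp.odd_of_ne_two hp).pow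
  induction j with
  | zero => simp
  | succ j ih =>
    rw [mul_add, mul_one, pow_add, pow_mul, ih, mul_pow, h, ← pow_mul, mul_comm j, pow_mul,
      hodd.neg_one_pow]
    ring

lemma pow_gcd_sub_one_eq_one {x : F} (hx : x ≠ 0) (hF : Nat.card F = p ^ m)
    (h : x ^ (p ^ k - 1) = 1) : x ^ (p ^ m.gcd k - 1) = 1 := by
  have := Fintype.ofFinite F
  have h2 : x ^ (p ^ m - 1) = 1 := by
    rw [← hF, Nat.card_eq_fintype_card]; exact FiniteField.pow_card_sub_one_eq_one x hx
  rw [← orderOf_dvd_iff_pow_eq_one] at h h2 ⊢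
  rw [← Nat.pow_sub_one_gcd_pow_sub_one]
  exact Nat.dvd_gcd h2 h

lemma pow_eq_self_iff_pow_sub_one {x : F} (hx : x ≠ 0) :
    x ^ p ^ k = x ↔ x ^ (p ^ k - 1) = 1 := by
  have hpp : p.Prime := Fact.out
  have hpk : p ^ k = (p ^ k - 1) + 1 := by
    have : 0 < p ^ k := pow_pos hpp.pos _
    omega
  conv_lhs => rw [hpk, pow_succ]
  exact mul_eq_right₀ hx

/-- The fixed points of `x ↦ x ^ p ^ k` in the field with `p ^ m` elements form the field with
`p ^ gcd m k` elements. -/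
lemma card_pow_eq_self [DecidableEq F] [Fintype F] (hm : m ≠ 0) (hF : Nat.card F = p ^ m) {π : F}
    (hπ : IsPrimitiveRoot π (p ^ m - 1)) :
    (Finset.univ.filter fun x : F => x ^ p ^ k = x).card = p ^ m.gcd k := by
  have hpp : p.Prime := Fact.out
  set d := m.gcd k with hd
  have hd0 : d ≠ 0 := (Nat.gcd_pos_of_pos_left _ (Nat.pos_of_ne_zero hm)).ne'
  have hpd : 1 < p ^ d := Nat.one_lt_pow hd0 hpp.one_lt
  have hpm : 1 < p ^ m := Nat.one_lt_pow hm hpp.one_lt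
  have hdvd : ∀ e, d ∣ e → p ^ d - 1 ∣ p ^ e - 1 := by
    rintro e ⟨f, rfl⟩
    rw [pow_mul]; exact Nat.sub_one_dvd_pow_sub_one _ _
  obtain ⟨t, ht⟩ := hdvd m (Nat.gcd_dvd_left m k)
  have hζ : IsPrimitiveRoot (π ^ t) (p ^ d - 1) :=
    hπ.pow (by omega) (by rw [ht, mul_comm])
  have hset : (Finset.univ.filter fun x : F => x ^ p ^ k = x) =
      insert 0 (nthRootsFinset (p ^ d - 1) (1 : F)) := by
    ext x
    simp only [Finset.mem_filter, Finset.mem_univ, true_and, Finset.mem_insert,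
      mem_nthRootsFinset (by omega : 0 < p ^ d - 1)]
    by_cases hx : x = 0
    · simp [hx, hpp.ne_zero]
    · simp only [hx, false_or]
      rw [pow_eq_self_iff_pow_sub_one hx]
      constructor
      · exact pow_gcd_sub_one_eq_one hx hF
      · intro h
        obtain ⟨s, hs⟩ := hdvd k (Nat.gcd_dvd_right m k)
        rw [hs, pow_mul, h, one_pow]
  rw [hset, Finset.card_insert_of_notMem, hζ.card_nthRootsFinset]
  · omega
  · rw [mem_nthRootsFinset (by omega), zero_pow (by omega)]
    exact zero_ne_one

/-- The `p ^ k`-power Frobenius and the trace character make up a `TwistedSetting`. -/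
theorem exists_frobeniusSetting (hp : p ≠ 2) {n l : ℕ} (hm2 : Even m) (hk2 : Even k)
    (hn : Odd n) (hkn : k * n = m * l) (hF : Nat.card F = p ^ m) :
    ∃ T : TwistedSetting F, (∀ x, T.σ x = x ^ p ^ k) ∧
      ∀ x, T.ψ x = ZMod.stdAddChar (Algebra.trace (ZMod p) F x) := by
  classical
  have := Fintype.ofFinite F
  have hpp : p.Prime := Fact.out
  have hodd : Odd p := hpp.odd_of_ne_two hp
  have hchar : CharP F p := charP_of_injective_algebraMap (algebraMap (ZMod p) F).injective p
  have : ExpChar F p := ExpChar.prime hpp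
  set σ : F ≃+* F := iterateFrobeniusEquiv F p k with hσ
  have hσx : ∀ x, σ x = x ^ p ^ k := fun x => iterateFrobeniusEquiv_def F p k x
  set ψ : AddChar F ℂ := (ZMod.stdAddChar (N := p)).compAddMonoidHom
    (Algebra.trace (ZMod p) F).toAddMonoidHom with hψ
  have hψx : ∀ x, ψ x = ZMod.stdAddChar (Algebra.trace (ZMod p) F x) := fun x => rfl
  have hneg1 : IsSquare (-1 : F) := by
    simpa using isSquare_algebraMap_zmod hp hm2 hF (-1)
  have htwo : IsSquare (2 : F) := by
    simpa only [map_ofNat] using isSquare_algebraMap_zmod hp hm2 hF 2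
  have h2 : (2 : F) ≠ 0 := by
    have := Ring.two_ne_zero (R := F) (by rwa [ringChar.eq F p])
    exact this
  have hinv : ∀ x, ψ (σ x) = ψ x := by
    intro x
    let φ : F ≃ₐ[ZMod p] F := AlgEquiv.ofRingEquiv (f := σ) fun r =>
      RingHom.congr_fun (Subsingleton.elim (σ.toRingHom.comp (algebraMap (ZMod p) F))
        (algebraMap (ZMod p) F)) r
    rw [hψx, hψx]
    congr 1
    exact Algebra.trace_eq_of_algEquiv φ x
  have hno : ∀ x, σ x = -x → x = 0 := by
    intro x hx
    rw [hσx] at hx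
    have h3 := pow_pow_mul_of_eq_neg hp hx n
    have h4 : x ^ p ^ (m * l) = x := by
      rw [pow_mul, ← hF, Nat.card_eq_fintype_card]; exact FiniteField.pow_card_pow l x
    rw [hkn, h4, hn.neg_one_pow] at h3
    have h5 : 2 * x = 0 := by linear_combination h3
    exact (mul_eq_zero.1 h5).resolve_left h2
  have hfix : ∀ z, σ (z ^ 2) = z ^ 2 → σ z = z := by
    intro z h
    rw [map_pow, sq_eq_sq_iff_eq_or_eq_neg] at h
    rcases h with h | h
    · exact h
    · rw [hno z h, map_zero]
  -- squaring is not injective on the fixed field, hence not surjective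
  obtain ⟨u, hu, hu'⟩ : ∃ u, σ u = u ∧ ¬ IsSquare u := by
    by_contra! hcon
    let f : {x // σ x = x} → {x // σ x = x} := fun x => ⟨x.1 ^ 2, by rw [map_pow, x.2]⟩
    have hsurj : Function.Surjective f := by
      rintro ⟨x, hx⟩
      obtain ⟨z, hz⟩ := hcon x hx
      rw [← sq] at hz
      exact ⟨⟨z, hfix z (hz ▸ hx)⟩, Subtype.ext hz.symm⟩
    have hinj := Finite.injective_iff_surjective.2 hsurj
    have h1 : f ⟨1, map_one σ⟩ = f ⟨-1, by rw [map_neg, map_one]⟩ := Subtype.ext (by simp [f])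
    have h3 := congrArg Subtype.val (hinj h1)
    simp only at h3
    exact h2 (by linear_combination h3)
  have hk4 : Odd ((p ^ k + 1) / 2) := by
    obtain ⟨r, rfl⟩ := hk2
    obtain ⟨s, hs⟩ := hodd.pow (n := r)
    rw [pow_add, hs]
    have : ((2 * s + 1) * (2 * s + 1) + 1) / 2 = 2 * (s * s + s) + 1 := by
      rw [show (2 * s + 1) * (2 * s + 1) + 1 = 2 * (2 * (s * s + s) + 1) by ring]
      omega
    exact ⟨_, this⟩
  have hmul : ∀ x, x * σ x = (x ^ ((p ^ k + 1) / 2)) ^ 2 := by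
    intro x
    rw [hσx, ← pow_mul, Nat.div_mul_cancel (hodd.pow.add_one.two_dvd), pow_succ']
  have hbij : Function.Bijective fun x : F => x ^ ((p ^ k + 1) / 2) := by
    rw [← Finite.injective_iff_bijective]
    intro x y hxy
    simp only at hxy
    by_cases hy : y = 0
    · subst hy
      rw [zero_pow hk4.pos.ne'] at hxy
      exact eq_zero_of_pow_eq_zero hxy
    have h3 : (x / y) ^ ((p ^ k + 1) / 2) = 1 := by
      rw [div_pow, hxy, div_self (pow_ne_zero _ hy)]
    have h4 : x / y * σ (x / y) = 1 := by rw [hmul, h3, one_pow]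
    set z := x / y with hz
    have hz0 : z ≠ 0 := left_ne_zero_of_mul_eq_one h4
    have h5 : σ z = z⁻¹ := eq_inv_of_mul_eq_one_right h4
    have h6 := hno (z - z⁻¹) (by rw [map_sub, map_inv₀, h5, inv_inv]; ring)
    have h7 : z ^ 2 = 1 := by
      have : z = z⁻¹ := by linear_combination h6
      field_simp at this
      exact this
    have h8 : z = 1 := by
      rcases sq_eq_one_iff.1 h7 with h | h
      · exact h
      · rw [h, hk4.neg_one_pow] at h3
        exact absurd (by linear_combination -h3) h2
    exact (div_eq_one_iff_eq hy).1 h8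
  have hprim : ψ.IsPrimitive := by
    refine AddChar.IsPrimitive.of_ne_one ?_
    obtain ⟨a, ha⟩ := Algebra.trace_surjective (ZMod p) F 1
    refine AddChar.ne_one_iff.2 ⟨a, fun h => ?_⟩
    rw [hψx, ha, ← AddChar.map_zero_eq_one (ZMod.stdAddChar (N := p))] at h
    exact one_ne_zero (ZMod.injective_stdAddChar h)
  exact ⟨⟨σ, ψ, u, fun x => x ^ ((p ^ k + 1) / 2), hprim, hinv, hno, hu, hu', hneg1, htwo, hbij,
    hmul⟩, hσx, hψx⟩

end frobenius

/-! ### Trace codes with two nonzeros -/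

section traceWord

variable (K : Type*) {F : Type*} [Field K] [Field F] [Algebra K F]

/-- The word `(Tr(α θ₁ ^ i + β θ₂ ^ i))` of length `N`, as a linear function of `(α, β)`. -/
noncomputable def traceWord (N : ℕ) (θ₁ θ₂ : F) : F × F →ₗ[K] (Fin N → K) where
  toFun x i := Algebra.trace K F (x.1 * θ₁ ^ (i : ℕ) + x.2 * θ₂ ^ (i : ℕ))
  map_add' x y := by
    ext i
    simp only [Prod.fst_add, Prod.snd_add, Pi.add_apply, ← map_add]
    congr 1; ring
  map_smul' t x := by
    ext i
    simp only [Prod.smul_fst, Prod.smul_snd, Pi.smul_apply, RingHom.id_apply, ← map_smul, smul_add,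
      smul_mul_assoc]

variable {K} {N : ℕ} {θ₁ θ₂ : F}

lemma traceWord_apply (x : F × F) (i : Fin N) : traceWord K N θ₁ θ₂ x i =
    Algebra.trace K F (x.1 * θ₁ ^ (i : ℕ) + x.2 * θ₂ ^ (i : ℕ)) := rfl

lemma pow_finRotate {θ : F} (h : θ ^ N = 1) (i : Fin N) :
    θ ^ (finRotate N i : ℕ) = θ ^ ((i : ℕ) + 1) := by
  obtain _ | n := N
  · exact i.elim0
  · rw [finRotate_apply, Fin.val_add_one]
    split_ifs with hi
    · rw [hi, Fin.val_last, h, pow_zero]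
    · rfl

lemma isCyclicCode_range_traceWord (h₁ : θ₁ ^ N = 1) (h₂ : θ₂ ^ N = 1) :
    IsCyclicCode (LinearMap.range (traceWord K N θ₁ θ₂)) := by
  rintro _ ⟨x, rfl⟩
  obtain rfl | hN := N.eq_zero_or_pos
  · exact ⟨0, funext fun i => i.elim0⟩
  have z₁ : θ₁ ≠ 0 := by rintro rfl; simp [hN.ne'] at h₁
  have z₂ : θ₂ ≠ 0 := by rintro rfl; simp [hN.ne'] at h₂
  refine ⟨(x.1 * θ₁⁻¹, x.2 * θ₂⁻¹), funext fun i => ?_⟩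
  obtain ⟨j, rfl⟩ := (finRotate N).surjective i
  rw [Equiv.symm_apply_apply, traceWord_apply, traceWord_apply, pow_finRotate h₁, pow_finRotate h₂]
  congr 1
  field_simp
  ring

lemma coeff_wordPolynomial (c : Fin N → K) (i : Fin N) : (wordPolynomial c).coeff i = c i := by
  simp only [wordPolynomial, finsetSum_coeff, coeff_C_mul, coeff_X_pow]
  rw [Finset.sum_eq_single_of_mem i (Finset.mem_univ _)]
  · simp
  · intro j _ hj
    rw [if_neg (fun h => hj (Fin.ext h.symm)), mul_zero]

lemma degree_wordPolynomial_lt (c : Fin N → K) : (wordPolynomial c).degree < N :=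
  degree_sum_fin_lt c

lemma geom_sum_eq_zero_of_pow_eq_one {x : F} (h : x ^ N = 1) (h1 : x ≠ 1) :
    ∑ i : Fin N, x ^ (i : ℕ) = 0 := by
  rw [Fin.sum_univ_eq_sum_range (fun i => x ^ i) N]
  have := geom_sum_mul x N
  rw [h, sub_self] at this
  exact (mul_eq_zero.1 this).resolve_right (sub_ne_zero.2 h1)

variable [Finite F]

lemma eval_wordPolynomial_traceWord (x : F × F) (ρ : F) :
    aeval ρ (wordPolynomial (traceWord K N θ₁ θ₂ x)) = ∑ s : F ≃ₐ[K] F,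
      (s x.1 * ∑ i : Fin N, (s θ₁ * ρ) ^ (i : ℕ) + s x.2 * ∑ i : Fin N, (s θ₂ * ρ) ^ (i : ℕ)) := by
  simp only [wordPolynomial, map_sum, map_mul, aeval_C, map_pow, aeval_X, traceWord_apply,
    trace_eq_sum_automorphisms, Finset.sum_mul, Finset.mul_sum, ← Finset.sum_add_distrib]
  rw [Finset.sum_comm]
  refine Finset.sum_congr rfl fun s _ => Finset.sum_congr rfl fun i _ => ?_
  rw [map_add, map_mul, map_mul, map_pow, map_pow]; ring

/-- Every `N`-th root of unity that is not conjugate to `θ₁⁻¹` or `θ₂⁻¹` is a zero of the words. -/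
lemma X_pow_sub_one_dvd_wordPolynomial_mul (h₁ : θ₁ ^ N = 1) (h₂ : θ₂ ^ N = 1) (hN : 0 < N)
    {ζ : F} (hζ : IsPrimitiveRoot ζ N) (x : F × F) :
    (X ^ N - 1 : K[X]) ∣
      wordPolynomial (traceWord K N θ₁ θ₂ x) * (minpoly K θ₂⁻¹ * minpoly K θ₁⁻¹) := by
  rw [← map_dvd_map' (algebraMap K F)]
  have hX : (X ^ N - 1 : K[X]).map (algebraMap K F) = X ^ N - 1 := by simp
  rw [hX, X_pow_sub_one_eq_prod hN hζ]
  refine Finset.prod_dvd_of_coprime (fun a _ b _ hab => pairwise_coprime_X_sub_C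
    Function.injective_id hab) fun ρ hρ => ?_
  rw [mem_nthRootsFinset hN] at hρ
  rw [dvd_iff_isRoot, IsRoot.def, eval_map_algebraMap, map_mul, map_mul]
  have hconj : ∀ θ : F, (∃ s : F ≃ₐ[K] F, s θ * ρ = 1) → aeval ρ (minpoly K θ⁻¹) = 0 := by
    rintro θ ⟨s, hs⟩
    rw [show ρ = s θ⁻¹ by rw [map_inv₀]; exact eq_inv_of_mul_eq_one_right hs,
      aeval_algHom_apply, minpoly.aeval, map_zero]
  by_cases c₁ : ∃ s : F ≃ₐ[K] F, s θ₁ * ρ = 1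
  · rw [hconj _ c₁]; simp
  by_cases c₂ : ∃ s : F ≃ₐ[K] F, s θ₂ * ρ = 1
  · rw [hconj _ c₂]; simp
  push Not at c₁ c₂
  rw [eval_wordPolynomial_traceWord, Finset.sum_eq_zero, zero_mul]
  intro s _
  rw [geom_sum_eq_zero_of_pow_eq_one _ (c₁ s), geom_sum_eq_zero_of_pow_eq_one _ (c₂ s)]
  · ring
  · rw [mul_pow, ← map_pow, h₂, map_one, hρ, one_mul]
  · rw [mul_pow, ← map_pow, h₁, map_one, hρ, one_mul]

/-- If `θ₁` and `θ₂` were conjugate, `(α, β) = (1, -1)` would give the zero word. -/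
lemma minpoly_inv_ne (hinj : Function.Injective (traceWord K N θ₁ θ₂)) :
    minpoly K θ₂⁻¹ ≠ minpoly K θ₁⁻¹ := by
  intro h
  obtain ⟨s, hs⟩ := (Normal.minpoly_eq_iff_mem_orbit F).1 h
  have hs' : s θ₁ = θ₂ := by
    have : s θ₁⁻¹ = θ₂⁻¹ := hs
    rwa [map_inv₀, inv_inj] at this
  have h0 : traceWord K N θ₁ θ₂ (1, -1) = 0 := by
    ext i
    rw [traceWord_apply, ← hs']
    simp only [one_mul, neg_mul, map_add, map_neg, ← map_pow, Pi.zero_apply]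
    rw [Algebra.trace_eq_of_algEquiv s, add_neg_cancel]
  have := hinj (h0.trans (map_zero _).symm)
  simp at this

/-- Comparing dimensions, the words of the code are all multiples of
`(X ^ N - 1) / (h₁ h₂)`, where `h₁`, `h₂` are the minimal polynomials of `θ₁⁻¹`, `θ₂⁻¹`. -/
theorem hasParityCheckPolynomial_range_traceWord (h₁ : θ₁ ^ N = 1) (h₂ : θ₂ ^ N = 1) (hN : 0 < N)
    {ζ : F} (hζ : IsPrimitiveRoot ζ N) (hinj : Function.Injective (traceWord K N θ₁ θ₂)) :
    HasParityCheckPolynomial (LinearMap.range (traceWord K N θ₁ θ₂))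
      (minpoly K θ₂⁻¹ * minpoly K θ₁⁻¹) := by
  have i₁ : IsIntegral K θ₁⁻¹ := Algebra.IsIntegral.isIntegral _
  have i₂ : IsIntegral K θ₂⁻¹ := Algebra.IsIntegral.isIntegral _
  have d₁ : minpoly K θ₁⁻¹ ∣ X ^ N - 1 := minpoly.dvd _ _ (by simp [h₁])
  have d₂ : minpoly K θ₂⁻¹ ∣ X ^ N - 1 := minpoly.dvd _ _ (by simp [h₂])
  have hcop : IsCoprime (minpoly K θ₂⁻¹) (minpoly K θ₁⁻¹) := by
    rw [(minpoly.irreducible i₂).coprime_iff_not_dvd]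
    intro hd
    exact minpoly_inv_ne hinj (eq_of_monic_of_associated (minpoly.monic i₂) (minpoly.monic i₁)
      ((minpoly.irreducible i₂).associated_of_dvd (minpoly.irreducible i₁) hd))
  set h := minpoly K θ₂⁻¹ * minpoly K θ₁⁻¹ with hh
  have hmon : h.Monic := (minpoly.monic i₂).mul (minpoly.monic i₁)
  obtain ⟨g, hg⟩ : h ∣ X ^ N - 1 := hcop.mul_dvd d₂ d₁
  rw [mul_comm] at hg
  have hgm : g.Monic := hmon.of_mul_monic_right (by
    rw [← hg]; exact monic_X_pow_sub_C 1 hN.ne')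
  have hdeg : g.natDegree + h.natDegree = N := by
    rw [← hgm.natDegree_mul hmon, ← hg]
    exact natDegree_X_pow_sub_C (r := (1 : K))
  refine ⟨g, hgm, hg.symm, fun c => ?_⟩
  have hmem : Ideal.Quotient.mk (Ideal.span {(X ^ N - 1 : K[X])}) (wordPolynomial c) ∈
      Ideal.span {Ideal.Quotient.mk (Ideal.span {(X ^ N - 1 : K[X])}) g} ↔
      g ∣ wordPolynomial c := by
    rw [Ideal.mem_span_singleton]
    constructor
    · rintro ⟨b, hb⟩
      obtain ⟨b, rfl⟩ := Ideal.Quotient.mk_surjective b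
      rw [← map_mul, Ideal.Quotient.mk_eq_mk_iff_sub_mem, Ideal.mem_span_singleton] at hb
      have := (Dvd.intro _ hg.symm).trans hb
      exact (dvd_sub_left (Dvd.intro b rfl)).1 this
    · exact fun hd => map_dvd _ hd
  rw [hmem]
  -- the linear map `u ↦ g u` on polynomials of degree less than `deg h`
  let L : degreeLT K h.natDegree →ₗ[K] (Fin N → K) :=
    { toFun := fun u i => (g * (u : K[X])).coeff i
      map_add' := fun u v => by ext i; simp [mul_add]
      map_smul' := fun t u => by ext i; simp }
  have hsub : ∀ c : Fin N → K, g ∣ wordPolynomial c → c ∈ LinearMap.range L := by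
    rintro c ⟨u, hu⟩
    refine ⟨⟨u, ?_⟩, funext fun i => ?_⟩
    · rw [mem_degreeLT]
      have hlt := degree_wordPolynomial_lt c
      by_cases hu0 : u = 0
      · rw [hu0, degree_zero]; exact WithBot.bot_lt_coe _
      rw [hu, degree_mul, degree_eq_natDegree hgm.ne_zero, degree_eq_natDegree hu0] at hlt
      rw [degree_eq_natDegree hu0]
      norm_cast at hlt ⊢
      omega
    · change (g * u).coeff i = c i
      rw [← hu, coeff_wordPolynomial]
  have hle : ∀ c ∈ LinearMap.range (traceWord K N θ₁ θ₂), g ∣ wordPolynomial c := by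
    rintro _ ⟨x, rfl⟩
    have := X_pow_sub_one_dvd_wordPolynomial_mul (K := K) h₁ h₂ hN hζ x
    rw [hg] at this
    exact (mul_dvd_mul_iff_right hmon.ne_zero).1 this
  have heq : LinearMap.range (traceWord K N θ₁ θ₂) = LinearMap.range L := by
    refine Submodule.eq_of_le_of_finrank_le (fun c hc => hsub c (hle c hc)) ?_
    have hfin : Module.Finite K (degreeLT K h.natDegree) :=
      Module.Finite.equiv (degreeLTEquiv K h.natDegree).symm
    refine (LinearMap.finrank_range_le L).trans ?_
    rw [LinearMap.finrank_range_of_inj hinj, (degreeLTEquiv K _).finrank_eq, Module.finrank_fin_fun,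
      Module.finrank_prod]
    exact (natDegree_mul_le).trans
      (Nat.add_le_add (minpoly.natDegree_le _) (minpoly.natDegree_le _))
  exact ⟨hle c, fun hd => heq ▸ hsub c hd⟩

end traceWord

/-! ### Weights of the code words -/

lemma sum_range_two_mul {M : Type*} [AddCommMonoid M] (h : ℕ → M) (N : ℕ) :
    ∑ i ∈ Finset.range (2 * N), h i = ∑ j ∈ Finset.range N, (h (2 * j) + h (2 * j + 1)) := by
  induction N with
  | zero => simp
  | succ N ih =>
    rw [Finset.sum_range_succ, ← ih, show 2 * (N + 1) = 2 * N + 1 + 1 by ring,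
      Finset.sum_range_succ, Finset.sum_range_succ, add_assoc]

lemma sum_range_pow_primitiveRoot {F M : Type*} [Field F] [Fintype F] [DecidableEq F]
    [AddCommMonoid M] {π : F} (hπ : IsPrimitiveRoot π (Fintype.card F - 1)) (f : F → M) :
    f 0 + ∑ j ∈ Finset.range (Fintype.card F - 1), f (π ^ j) = ∑ x, f x := by
  have hN : 0 < Fintype.card F - 1 := by have := Fintype.one_lt_card (α := F); omega
  have hinj : Set.InjOn (fun j => π ^ j) (Finset.range (Fintype.card F - 1)) := by
    intro i hi j hj h
    exact hπ.pow_inj (by simpa using hi) (by simpa using hj) h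
  have h : (Finset.range (Fintype.card F - 1)).image (fun j => π ^ j) = Finset.univ.erase 0 := by
    refine Finset.eq_of_subset_of_card_le ?_ ?_
    · intro x hx
      obtain ⟨j, _, rfl⟩ := Finset.mem_image.1 hx
      exact Finset.mem_erase.2 ⟨pow_ne_zero _ (hπ.ne_zero hN.ne'), Finset.mem_univ _⟩
    · rw [Finset.card_image_of_injOn hinj, Finset.card_erase_of_mem (Finset.mem_univ _)]
      simp
  rw [← Finset.add_sum_erase _ f (Finset.mem_univ 0), ← h, Finset.sum_image hinj]

section weights

set_option linter.unusedSectionVars false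

variable {p m k : ℕ} [Fact p.Prime] {F : Type*} [Field F] [Fintype F] [DecidableEq F]
  [Algebra (ZMod p) F] {T : TwistedSetting F} {π : F}

/-- Splitting the positions by parity turns the character sum along a word into the sums of two
forms. -/
lemma two_mul_sum_ψ (hp : p ≠ 2) (hσ : ∀ x, T.σ x = x ^ p ^ k)
    (hπ : IsPrimitiveRoot π (Fintype.card F - 1)) (α β : F) :
    2 * ∑ i ∈ Finset.range (Fintype.card F - 1),
      T.ψ (α * (π ^ ((p ^ k + 1) / 2)) ^ i + β * (-π) ^ i) =
    T.formSum α β + T.formSum (α * π ^ ((p ^ k + 1) / 2)) (β * -π) - 2 := by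
  have hpp : p.Prime := Fact.out
  have h2 : (p ^ k + 1) / 2 * 2 = p ^ k + 1 :=
    Nat.div_mul_cancel ((hpp.odd_of_ne_two hp).pow.add_one.two_dvd)
  have hπ0 : π ≠ 0 := hπ.ne_zero (by have := Fintype.one_lt_card (α := F); omega)
  set θ₁ := π ^ ((p ^ k + 1) / 2) with hθ
  set N := Fintype.card F - 1 with hN
  set h : ℕ → ℂ := fun i => T.ψ (α * θ₁ ^ i + β * (-π) ^ i) with hh
  have hper : ∀ i, h (N + i) = h i := by
    intro i
    have h1 : ∀ x : F, x ≠ 0 → x ^ N = 1 := fun x hx => FiniteField.pow_card_sub_one_eq_one x hx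
    simp only [hh, pow_add, h1 θ₁ (pow_ne_zero _ hπ0), h1 _ (neg_ne_zero.2 hπ0), one_mul]
  have hdouble : ∑ i ∈ Finset.range (2 * N), h i = 2 * ∑ i ∈ Finset.range N, h i := by
    rw [two_mul N, Finset.sum_range_add, two_mul]
    simp_rw [hper]
  have hθ2 : ∀ j, θ₁ ^ (2 * j) = π ^ j * T.σ (π ^ j) := by
    intro j
    rw [hσ, hθ, ← pow_mul, ← mul_assoc, h2, ← pow_mul, ← pow_add]
    congr 1; ring
  have hπ2 : ∀ j, (-π) ^ (2 * j) = (π ^ j) ^ 2 := by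
    intro j
    rw [pow_mul, neg_sq, ← pow_mul, ← pow_mul, mul_comm]
  rw [← hdouble, sum_range_two_mul, Finset.sum_add_distrib]
  have e1 := sum_range_pow_primitiveRoot hπ fun x => T.ψ (α * (x * T.σ x) + β * x ^ 2)
  have e2 := sum_range_pow_primitiveRoot hπ
    fun x => T.ψ (α * θ₁ * (x * T.σ x) + β * -π * x ^ 2)
  have f1 : ∀ j, h (2 * j) = T.ψ (α * (π ^ j * T.σ (π ^ j)) + β * (π ^ j) ^ 2) := by
    intro j
    simp only [hh, hθ2, hπ2]
  have f2 : ∀ j, h (2 * j + 1) =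
      T.ψ (α * θ₁ * (π ^ j * T.σ (π ^ j)) + β * -π * (π ^ j) ^ 2) := by
    intro j
    simp only [hh, pow_succ _ (2 * j), hθ2, hπ2]
    congr 1; ring
  simp_rw [f1, f2]
  unfold TwistedSetting.formSum
  rw [← e1, ← e2]
  simp only [zero_mul, mul_zero, ne_eq, OfNat.ofNat_ne_zero, not_false_eq_true, zero_pow, add_zero,
    AddChar.map_zero_eq_one]
  ring

/-- The primitive element is `u w²`, and `u ^ ((p ^ k + 1) / 2) = u` because `k / gcd m k` is
even. -/
lemma formSum_mul_primitiveRoot (hp : p ≠ 2) (hσ : ∀ x, T.σ x = x ^ p ^ k)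
    (hF : Nat.card F = p ^ m) {l : ℕ} (hl : Even l) (hkl : k = m.gcd k * l)
    (hπ : IsPrimitiveRoot π (Fintype.card F - 1)) (α β : F) :
    T.formSum (α * π ^ ((p ^ k + 1) / 2)) (β * -π) = T.formSum (T.u * α) (-(T.u * β)) := by
  have hpp : p.Prime := Fact.out
  have hodd := hpp.odd_of_ne_two hp
  have hcard : Odd (Fintype.card F) := by
    rw [← Nat.card_eq_fintype_card, hF]; exact hodd.pow
  have hone : 1 < Fintype.card F := Fintype.one_lt_card
  have hπ0 : π ≠ 0 := hπ.ne_zero (by omega)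
  have hnsq : ¬ IsSquare π := by
    rintro ⟨z, rfl⟩
    have hz : z ≠ 0 := by rintro rfl; simp at hπ0
    obtain ⟨t, ht⟩ := hcard
    have h1 : (z * z) ^ t = 1 := by
      rw [← sq, ← pow_mul, show 2 * t = Fintype.card F - 1 by omega]
      exact FiniteField.pow_card_sub_one_eq_one z hz
    have := Nat.le_of_dvd (by omega) (hπ.dvd_of_pow_eq_one t h1)
    omega
  obtain ⟨w, hw⟩ := exists_eq_sq_or_eq_mul_sq T.not_isSquare_u π
  replace hw := hw.resolve_left fun h => hnsq ⟨w, by rw [h, sq]⟩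
  have hw0 : w ≠ 0 := by rintro rfl; simp at hw; exact hπ0 hw
  have hu : T.u ^ ((p ^ k + 1) / 2) = T.u := by
    have h1 : T.u ^ (p ^ k - 1) = 1 :=
      (pow_eq_self_iff_pow_sub_one T.u_ne_zero).1 (by rw [← hσ, T.σ_u])
    have h2 := pow_gcd_sub_one_eq_one T.u_ne_zero hF h1
    set d := m.gcd k
    obtain ⟨r, rfl⟩ := hl
    have h3 : (p ^ d - 1) * 2 ∣ p ^ k - 1 := by
      refine dvd_trans ?_ (?_ : (p ^ d) ^ 2 - 1 ∣ p ^ k - 1)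
      · rw [show (p ^ d) ^ 2 - 1 = (p ^ d - 1) * (p ^ d + 1) by
          rw [mul_comm, ← Nat.sq_sub_sq (p ^ d) 1, one_pow]]
        exact mul_dvd_mul_left _ hodd.pow.add_one.two_dvd
      · rw [hkl, ← two_mul, pow_mul, pow_mul]
        exact Nat.sub_one_dvd_pow_sub_one _ _
    obtain ⟨t, ht⟩ := h3
    have h4 : 0 < p ^ k := pow_pos hpp.pos _
    have h5 : (p ^ k + 1) / 2 = (p ^ d - 1) * t + 1 := by
      have : (p ^ d - 1) * 2 * t = 2 * ((p ^ d - 1) * t) := by ring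
      omega
    rw [h5, pow_succ, pow_mul, h2, one_pow, one_mul]
  have hθ : π ^ ((p ^ k + 1) / 2) = T.u * (w * T.σ w) := by
    rw [hw, mul_pow, hu, ← pow_mul, Nat.mul_div_cancel' hodd.pow.add_one.two_dvd, pow_succ', hσ]
  rw [← T.formSum_scale hw0 (T.u * α), hθ, hw]
  congr 1 <;> ring

/-- The weight of a word, in terms of the exponential sums of its two forms. -/
lemma two_mul_hammingNorm (hp : p ≠ 2) (hm2 : Even m) {l : ℕ} (hl : Even l)
    (hkl : k = m.gcd k * l) (hF : Nat.card F = p ^ m) (hσ : ∀ x, T.σ x = x ^ p ^ k)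
    (hψ : ∀ x, T.ψ x = ZMod.stdAddChar (Algebra.trace (ZMod p) F x))
    (hπ : IsPrimitiveRoot π (p ^ m - 1)) (α β : F) :
    2 * p * (hammingNorm (traceWord (ZMod p) (p ^ m - 1) (π ^ ((p ^ k + 1) / 2)) (-π) (α, β)) : ℂ) =
      (p - 1) * (2 * Fintype.card F -
        (T.formSum α β + T.formSum (T.u * α) (-(T.u * β)))) := by
  have hN : p ^ m - 1 = Fintype.card F - 1 := by rw [← hF, Nat.card_eq_fintype_card]
  have hone : 1 < Fintype.card F := Fintype.one_lt_card
  set N := p ^ m - 1 with hNdef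
  set c := traceWord (ZMod p) N (π ^ ((p ^ k + 1) / 2)) (-π) (α, β) with hc
  set s := T.formSum α β + T.formSum (T.u * α) (-(T.u * β)) with hs
  have hNc : (N : ℂ) = Fintype.card F - 1 := by
    rw [hN, Nat.cast_sub hone.le, Nat.cast_one]
  rw [hN] at hπ
  -- the number of zero positions, by orthogonality of the characters of the prime field
  have hzeros : ∑ i, ∑ y : ZMod p, ZMod.stdAddChar (y * c i) = (p : ℂ) * (N - hammingNorm c) := by
    have h1 : ∀ i, ∑ y : ZMod p, ZMod.stdAddChar (y * c i) =
        (p : ℂ) * (1 - if c i ≠ 0 then 1 else 0) := by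
      intro i
      rw [AddChar.sum_mulShift _ (ZMod.isPrimitive_stdAddChar p), ZMod.card]
      by_cases hi : c i = 0
      · rw [if_pos hi, if_neg (not_not.2 hi), sub_zero, mul_one]
      · rw [if_neg hi, if_pos hi, sub_self, mul_zero, Nat.cast_zero]
    simp_rw [h1]
    rw [← Finset.mul_sum, Finset.sum_sub_distrib, ← Finset.sum_filter]
    simp [hammingNorm]
  have hy : ∀ y : ZMod p, 2 * ∑ i, ZMod.stdAddChar (y * c i) =
      (s - 2) + if y = 0 then 2 * N - (s - 2) else 0 := by
    intro y
    split_ifs with hy0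
    · subst hy0; simp
    · obtain ⟨z, hz⟩ := isSquare_algebraMap_zmod hp hm2 hF y
      rw [← sq] at hz
      have hz0 : z ≠ 0 := by rintro rfl; simp at hz; exact hy0 hz
      have hσy : T.σ (algebraMap (ZMod p) F y) = algebraMap (ZMod p) F y :=
        RingHom.congr_fun (Subsingleton.elim (T.σ.toRingHom.comp (algebraMap (ZMod p) F))
          (algebraMap (ZMod p) F)) y
      have hσz : T.σ z = z := T.σ_eq_of_sq (by rw [← hz, hσy])
      have h1 : ∀ i : Fin N, ZMod.stdAddChar (y * c i) =
          T.ψ (z ^ 2 * α * (π ^ ((p ^ k + 1) / 2)) ^ (i : ℕ) + z ^ 2 * β * (-π) ^ (i : ℕ)) := by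
        intro i
        rw [hψ, hc, traceWord_apply, ← smul_eq_mul, ← map_smul, Algebra.smul_def, hz]
        congr 2; ring
      simp_rw [h1]
      rw [Fin.sum_univ_eq_sum_range (fun i => T.ψ (z ^ 2 * α * (π ^ ((p ^ k + 1) / 2)) ^ i +
        z ^ 2 * β * (-π) ^ i)), hN, two_mul_sum_ψ hp hσ hπ,
        formSum_mul_primitiveRoot hp hσ hF hl hkl hπ, T.formSum_fixed_scale hσz hz0,
        show T.u * (z ^ 2 * α) = z ^ 2 * (T.u * α) by ring,
        show -(T.u * (z ^ 2 * β)) = z ^ 2 * (-(T.u * β)) by ring,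
        T.formSum_fixed_scale hσz hz0, add_zero]
  rw [Finset.sum_comm] at hzeros
  have h3 : 2 * ∑ y : ZMod p, ∑ i, ZMod.stdAddChar (y * c i) = p * (s - 2) + (2 * N - (s - 2)) := by
    rw [Finset.mul_sum, Fintype.sum_congr _ _ hy, Finset.sum_add_distrib, Finset.sum_ite_eq',
      if_pos (Finset.mem_univ _), Finset.sum_const, Finset.card_univ, ZMod.card, nsmul_eq_mul]
  rw [hzeros] at h3
  linear_combination -h3 + 2 * (p - 1) * hNc

end weights

/-! ### The weight distribution -/

lemma tableFrequency_nil (w : ℕ) : tableFrequency [] w = 0 := by simp [tableFrequency]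

lemma tableFrequency_cons (r : ℚ × ℚ) (t : List (ℚ × ℚ)) (w : ℕ) :
    tableFrequency (r :: t) w = (if r.1 = w then 1 else 0) * r.2 + tableFrequency t w := by
  unfold tableFrequency
  rw [List.filter_cons]
  split_ifs <;> simp_all

lemma traceCode_eq_range (p m k : ℕ) [Fact p.Prime] {F : Type*} [Field F] [Algebra (ZMod p) F]
    (π : F) : traceCode p m k π =
      LinearMap.range (traceWord (ZMod p) (p ^ m - 1) (π ^ ((p ^ k + 1) / 2)) (-π)) := by
  ext c
  constructor
  · rintro ⟨α, β, h⟩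
    refine ⟨(α, β), funext fun i => ?_⟩
    rw [h i, traceWord_apply, pow_mul]
  · rintro ⟨⟨α, β⟩, rfl⟩
    exact ⟨α, β, fun i => by rw [traceWord_apply, pow_mul]⟩

lemma weightFrequency_range {K V : Type*} [Field K] [DecidableEq K] [AddCommGroup V] [Module K V]
    [Fintype V] {N : ℕ} (f : V →ₗ[K] (Fin N → K)) (hf : Function.Injective f) (w : ℕ) :
    weightFrequency (LinearMap.range f) w =
      (Finset.univ.filter fun x => hammingNorm (f x) = w).card := by
  rw [weightFrequency, ← Fintype.card_subtype, ← Nat.card_eq_fintype_card]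
  refine (Nat.card_congr (Equiv.ofBijective
    (fun x : {x // hammingNorm (f x) = w} => ⟨f x.1, ⟨x.1, rfl⟩, x.2⟩) ⟨?_, ?_⟩)).symm
  · intro x y h
    exact Subtype.ext (hf (congrArg Subtype.val h))
  · rintro ⟨_, ⟨x, rfl⟩, hw⟩
    exact ⟨⟨x, hw⟩, rfl⟩

/-- The table in terms of `P = p`, `a = p ^ (d / 2)` and `b = p ^ ((m - d) / 2 - 1)`. -/
lemma weightTable_eq (p e f : ℕ) {P a b : ℚ} (hP : P = p) (ha : a = P ^ e) (hb : b = P ^ f) :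
    weightTable p (e + 1 + f + (e + 1 + f)) (e + e) =
    let B : ℚ := P * a ^ 2 * b ^ 2 * (P - 1)
    let E : ℚ := (P - 1) * (a * b)
    let q : ℚ := P ^ 2 * a ^ 2 * b ^ 2
    [ (0, 1),
      (B + 1 / 2 * (a ^ 2 - 1) * E, (P ^ 2 * b ^ 2 - 1) * (q - 1) / (a ^ 4 - 1)),
      (B - 1 / 2 * (a ^ 2 - 1) * E, (P ^ 2 * b ^ 2 - 1) * (q - 1) / (a ^ 4 - 1)),
      (B + 1 / 2 * (a - 1) * E, 1 / 2 * (P * b) * (P * b - 1) * (q - 1)),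
      (B + 1 / 2 * (a + 1) * E, 1 / 2 * (P * b) * (P * b - 1) * (q - 1)),
      (B - 1 / 2 * (a + 1) * E, 1 / 2 * (P * b) * (P * b + 1) * (q - 1)),
      (B - 1 / 2 * (a - 1) * E, 1 / 2 * (P * b) * (P * b + 1) * (q - 1)),
      (B + E, 1 / 4 * (a ^ 2 - 1) * (q ^ 2 - 1) / (a ^ 2 + 1)),
      (B - E, 1 / 4 * (a ^ 2 - 1) * (q ^ 2 - 1) / (a ^ 2 + 1)),
      (B, 1 / 2 * (q * a ^ 2 - 3 * q + a ^ 2 + 1) * (q - 1) / (a ^ 2 - 1)) ] := by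
  subst hP
  have h1 : (p : ℚ) ^ (e + 1 + f + (e + 1 + f) - 1) = p * a ^ 2 * b ^ 2 := by
    rw [show e + 1 + f + (e + 1 + f) - 1 = 1 + e * 2 + f * 2 by omega, ha, hb]; ring
  have h2 : (p : ℚ) ^ ((e + 1 + f + (e + 1 + f)) / 2 - 1) = a * b := by
    rw [show (e + 1 + f + (e + 1 + f)) / 2 - 1 = e + f by omega, ha, hb]; ring
  have h3 : (p : ℚ) ^ ((e + 1 + f + (e + 1 + f) - (e + e)) / 2) = p * b := by
    rw [show (e + 1 + f + (e + 1 + f) - (e + e)) / 2 = f + 1 by omega, hb]; ring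
  have h4 : (p : ℚ) ^ (e + 1 + f + (e + 1 + f) - (e + e)) = p ^ 2 * b ^ 2 := by
    rw [show e + 1 + f + (e + 1 + f) - (e + e) = 2 + f * 2 by omega, hb]; ring
  have h5 : (p : ℚ) ^ (2 * (e + e)) = a ^ 4 := by rw [ha]; ring
  have h6 : (p : ℚ) ^ ((e + e) / 2) = a := by rw [show (e + e) / 2 = e by omega, ha]
  have h7 : (p : ℚ) ^ (2 * (e + 1 + f + (e + 1 + f))) = (p ^ 2 * a ^ 2 * b ^ 2) ^ 2 := by
    rw [ha, hb]; ring
  have h8 : (p : ℚ) ^ (e + 1 + f + (e + 1 + f) + (e + e)) = p ^ 2 * a ^ 2 * b ^ 2 * a ^ 2 := by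
    rw [ha, hb]; ring
  have h9 : (p : ℚ) ^ (e + 1 + f + (e + 1 + f)) = p ^ 2 * a ^ 2 * b ^ 2 := by
    rw [ha, hb]; ring
  have h10 : (p : ℚ) ^ (e + e) = a ^ 2 := by rw [ha]; ring
  simp only [weightTable, h1, h2, h3, h4, h5, h6, h7, h8, h9, h10]

section distribution

variable {F : Type*} [Field F] [Fintype F] [DecidableEq F]

/-- The sum of a form and its companion reaches `2 q` for the zero form only. -/
lemma eq_zero_of_formSum_add_eq (T : TwistedSetting F) {g g₀ : ℕ} (hg : g ^ 2 = Fintype.card F)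
    (hg₀ : g₀ ^ 2 = T.fixed.card) (hle : T.fixed.card ≤ g) (hg₂ : 2 ≤ g) {α β : F}
    (h : T.formSum α β + T.formSum (T.u * α) (-(T.u * β)) = 2 * Fintype.card F) :
    α = 0 ∧ β = 0 := by
  classical
  have hgc : (g : ℂ) ^ 2 = Fintype.card F := by exact_mod_cast hg
  have hgc₀ : (g₀ : ℂ) ^ 2 = T.fixed.card := by exact_mod_cast hg₀
  have hone := T.one_lt_card_fixed
  have hsum := T.sum_distribution hgc hgc₀ fun t => if t = 2 * Fintype.card F then 1 else 0
  have hz : ∀ z : ℤ, z < 2 * (g : ℤ) ^ 2 →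
      (if (z : ℂ) = 2 * Fintype.card F then (1 : ℂ) else 0) = 0 := by
    intro z hz
    rw [if_neg]
    rw [← hgc]
    intro h
    have : z = 2 * (g : ℤ) ^ 2 := by exact_mod_cast h
    omega
  have b1 : (T.fixed.card : ℤ) ≤ g := by exact_mod_cast hle
  have b2 : (2 : ℤ) ≤ g := by exact_mod_cast hg₂
  have b3 : (g₀ : ℤ) ^ 2 = T.fixed.card := by exact_mod_cast hg₀
  have b4 : (1 : ℤ) < T.fixed.card := by exact_mod_cast hone
  have b5 : (g₀ : ℤ) ≤ g := by nlinarith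
  have b6 : (0 : ℤ) ≤ g₀ := by positivity
  have v1 := hz (g * T.fixed.card - g) (by nlinarith)
  have v2 := hz (-(g * T.fixed.card - g)) (by nlinarith)
  have v3 := hz (g * g₀ - g) (by nlinarith)
  have v4 := hz (g * g₀ + g) (by nlinarith)
  have v5 := hz (-(g * g₀ - g)) (by nlinarith)
  have v6 := hz (-(g * g₀ + g)) (by nlinarith)
  have v7 := hz (2 * g) (by nlinarith)
  have v8 := hz (-(2 * g)) (by nlinarith)
  have v9 := hz 0 (by nlinarith)
  push_cast at v1 v2 v3 v4 v5 v6 v7 v8 v9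
  simp only [v1, v2, v3, v4, v5, v6, v7, v8, v9, add_zero, mul_zero, if_true] at hsum
  rw [← Fintype.sum_prod_type' (f := fun α β => if T.formSum α β +
    T.formSum (T.u * α) (-(T.u * β)) = 2 * Fintype.card F then (1 : ℂ) else 0),
    ← Finset.sum_filter, Finset.sum_const, nsmul_eq_mul, mul_one] at hsum
  obtain ⟨x, hx⟩ := Finset.card_eq_one.1 (by exact_mod_cast hsum)
  have m1 : (α, β) ∈ ({x} : Finset (F × F)) := by rw [← hx]; simp [h]
  have m0 : (0, 0) ∈ ({x} : Finset (F × F)) := by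
    rw [← hx]
    simp [TwistedSetting.formSum, two_mul]
  rw [Finset.mem_singleton] at m0 m1
  have := m1.trans m0.symm
  exact ⟨congrArg Prod.fst this, congrArg Prod.snd this⟩

/-- The distribution of the forms, rewritten as the table of weights. -/
lemma card_hammingNorm_eq (T : TwistedSetting F) {p m d : ℕ} [Fact p.Prime] {N : ℕ}
    (hm2 : Even m) (hd2 : Even d) (hd0 : 0 < d) (hdm : d < m) (hF : Fintype.card F = p ^ m)
    (hfix : T.fixed.card = p ^ d) (c : F × F → Fin N → ZMod p)
    (hc : ∀ α β, 2 * p * (hammingNorm (c (α, β)) : ℂ) = (p - 1) * (2 * Fintype.card F -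
        (T.formSum α β + T.formSum (T.u * α) (-(T.u * β))))) (w : ℕ) :
    ((Finset.univ.filter fun x => hammingNorm (c x) = w).card : ℚ) =
      tableFrequency (weightTable p m d) w := by
  classical
  have hpp : p.Prime := Fact.out
  have hpc : (p : ℂ) ≠ 0 := by exact_mod_cast hpp.ne_zero
  obtain ⟨r, rfl⟩ := hm2
  obtain ⟨e, rfl⟩ := hd2
  obtain ⟨f, rfl⟩ : ∃ f, r = e + 1 + f := ⟨r - (e + 1), by omega⟩
  have hgc : ((p ^ (e + 1 + f) : ℕ) : ℂ) ^ 2 = Fintype.card F := by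
    rw [hF]; push_cast; ring
  have hgc₀ : ((p ^ e : ℕ) : ℂ) ^ 2 = T.fixed.card := by rw [hfix]; push_cast; ring
  have hsum := T.sum_distribution hgc hgc₀
    fun t => if (p - 1) * (2 * Fintype.card F - t) = 2 * p * (w : ℂ) then 1 else 0
  have hleft : ∑ α, ∑ β, (if (p - 1) * (2 * Fintype.card F -
      (T.formSum α β + T.formSum (T.u * α) (-(T.u * β)))) = 2 * p * (w : ℂ) then (1 : ℂ) else 0) =
      (Finset.univ.filter fun x => hammingNorm (c x) = w).card := by
    rw [Finset.card_filter, Fintype.sum_prod_type]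
    push_cast
    refine Finset.sum_congr rfl fun α _ => Finset.sum_congr rfl fun β _ => ?_
    rw [← hc]
    congr 1
    rw [mul_right_inj' (mul_ne_zero two_ne_zero hpc), Nat.cast_inj]
  rw [hleft] at hsum
  clear hleft
  obtain ⟨P, hP⟩ : ∃ P : ℚ, P = p := ⟨_, rfl⟩
  obtain ⟨a, ha⟩ : ∃ a : ℚ, a = P ^ e := ⟨_, rfl⟩
  obtain ⟨b, hb⟩ : ∃ b : ℚ, b = P ^ f := ⟨_, rfl⟩
  have hcF : (Fintype.card F : ℂ) = ((P ^ 2 * a ^ 2 * b ^ 2 : ℚ) : ℂ) := by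
    rw [hF, ha, hb, hP]; push_cast; ring
  have hcK : (T.fixed.card : ℂ) = ((a ^ 2 : ℚ) : ℂ) := by
    rw [hfix, ha, hP]; push_cast; ring
  have hcg : ((p ^ (e + 1 + f) : ℕ) : ℂ) = ((P * a * b : ℚ) : ℂ) := by
    rw [ha, hb, hP]; push_cast; ring
  have hcg₀ : ((p ^ e : ℕ) : ℂ) = (a : ℂ) := by rw [ha, hP]; push_cast; ring
  have hcp : (p : ℂ) = (P : ℂ) := by rw [hP]; push_cast; rfl
  rw [weightTable_eq p e f hP ha hb]
  rw [hcF, hcK, hcg, hcg₀, hcp] at hsum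
  have ha1 : 1 < a := by
    rw [ha, hP]
    exact_mod_cast Nat.one_lt_pow (by omega) hpp.one_lt
  have hpq : P ≠ 0 := by rw [hP]; exact_mod_cast hpp.ne_zero
  -- the weight of a word whose two sums add up to `t` is `W`
  have hφ : ∀ t W : ℚ, (P - 1) * (2 * (P ^ 2 * a ^ 2 * b ^ 2) - t) = 2 * P * W →
      ∀ I : ℚ, (if W = w then 1 else 0) = I →
      (if ((P : ℂ) - 1) * (2 * ((P ^ 2 * a ^ 2 * b ^ 2 : ℚ) : ℂ) - (t : ℂ)) = 2 * P * (w : ℂ)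
        then (1 : ℂ) else 0) = (I : ℂ) := by
    rintro t W h _ rfl
    have hiff : ((P : ℂ) - 1) * (2 * ((P ^ 2 * a ^ 2 * b ^ 2 : ℚ) : ℂ) - (t : ℂ)) =
        2 * P * (w : ℂ) ↔ W = w := by
      rw [← mul_right_inj' (mul_ne_zero two_ne_zero hpq), ← h]
      exact_mod_cast Iff.rfl
    simp only [hiff]
    split_ifs <;> simp
  simp only [tableFrequency_cons, tableFrequency_nil, add_zero]
  generalize h0 : (if (0 : ℚ) = w then (1 : ℚ) else 0) = I0
  generalize h1 : (if P * a ^ 2 * b ^ 2 * (P - 1) + 1 / 2 * (a ^ 2 - 1) * ((P - 1) * (a * b)) = w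
    then (1 : ℚ) else 0) = I1
  generalize h2 : (if P * a ^ 2 * b ^ 2 * (P - 1) - 1 / 2 * (a ^ 2 - 1) * ((P - 1) * (a * b)) = w
    then (1 : ℚ) else 0) = I2
  generalize h3 : (if P * a ^ 2 * b ^ 2 * (P - 1) + 1 / 2 * (a - 1) * ((P - 1) * (a * b)) = w
    then (1 : ℚ) else 0) = I3
  generalize h4 : (if P * a ^ 2 * b ^ 2 * (P - 1) + 1 / 2 * (a + 1) * ((P - 1) * (a * b)) = w
    then (1 : ℚ) else 0) = I4
  generalize h5 : (if P * a ^ 2 * b ^ 2 * (P - 1) - 1 / 2 * (a + 1) * ((P - 1) * (a * b)) = w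
    then (1 : ℚ) else 0) = I5
  generalize h6 : (if P * a ^ 2 * b ^ 2 * (P - 1) - 1 / 2 * (a - 1) * ((P - 1) * (a * b)) = w
    then (1 : ℚ) else 0) = I6
  generalize h7 : (if P * a ^ 2 * b ^ 2 * (P - 1) + (P - 1) * (a * b) = w
    then (1 : ℚ) else 0) = I7
  generalize h8 : (if P * a ^ 2 * b ^ 2 * (P - 1) - (P - 1) * (a * b) = w
    then (1 : ℚ) else 0) = I8
  generalize h9 : (if P * a ^ 2 * b ^ 2 * (P - 1) = w then (1 : ℚ) else 0) = I9
  have g0 := hφ (2 * (P ^ 2 * a ^ 2 * b ^ 2)) _ (by ring) _ h0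
  have g1 := hφ (-(P * a * b * a ^ 2 - P * a * b)) _ (by ring) _ h1
  have g2 := hφ (P * a * b * a ^ 2 - P * a * b) _ (by ring) _ h2
  have g3 := hφ (-(P * a * b * a - P * a * b)) _ (by ring) _ h3
  have g4 := hφ (-(P * a * b * a + P * a * b)) _ (by ring) _ h4
  have g5 := hφ (P * a * b * a + P * a * b) _ (by ring) _ h5
  have g6 := hφ (P * a * b * a - P * a * b) _ (by ring) _ h6
  have g7 := hφ (-(2 * (P * a * b))) _ (by ring) _ h7
  have g8 := hφ (2 * (P * a * b)) _ (by ring) _ h8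
  have g9 := hφ 0 _ (by ring) _ h9
  push_cast at g0 g1 g2 g3 g4 g5 g6 g7 g8 g9 hsum
  rw [g0, g1, g2, g3, g4, g5, g6, g7, g8, g9] at hsum
  have hsumQ : ((Finset.univ.filter fun x => hammingNorm (c x) = w).card : ℚ) =
      I0 + (P ^ 2 * a ^ 2 * b ^ 2 - 1) *
        ((P ^ 2 * a ^ 2 * b ^ 2 / a ^ 2 - 1) / ((a ^ 2) ^ 2 - 1) * (I2 + I1) +
        1 / 2 * (P * a * b / a) * (P * a * b / a + 1) * (I6 + I5) +
        1 / 2 * (P * a * b / a) * (P * a * b / a - 1) * (I3 + I4) +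
        1 / 4 * (a ^ 2 - 1) * (P ^ 2 * a ^ 2 * b ^ 2 + 1) / (a ^ 2 + 1) * (I8 + I7) +
        1 / 2 * (P ^ 2 * a ^ 2 * b ^ 2 * a ^ 2 - 3 * (P ^ 2 * a ^ 2 * b ^ 2) + a ^ 2 + 1) /
          (a ^ 2 - 1) * I9) := by
    rw [← Rat.cast_inj (α := ℂ)]
    push_cast
    exact hsum
  have z0 : a ≠ 0 := by positivity
  have z1 : a ^ 2 - 1 ≠ 0 := by nlinarith
  have z2 : a ^ 2 + 1 ≠ 0 := by positivity
  have z3 : a ^ 4 - 1 ≠ 0 := by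
    rw [show a ^ 4 - 1 = (a ^ 2 - 1) * (a ^ 2 + 1) by ring]; exact mul_ne_zero z1 z2
  have k1 : P ^ 2 * a ^ 2 * b ^ 2 / a ^ 2 = P ^ 2 * b ^ 2 := by field_simp
  have k2 : P * a * b / a = P * b := by field_simp
  rw [hsumQ, k1, k2, show (a ^ 2) ^ 2 = a ^ 4 by ring]
  ring

end distribution

theorem mainTheorem2 (p m k : ℕ) [Fact p.Prime] (hp : p ≠ 2)
    (hs : 3 ≤ m / Nat.gcd m k)
    (hm : 1 ≤ padicValNat 2 m) (hmk : padicValNat 2 m < padicValNat 2 k)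
    (F : Type*) [Field F] [Algebra (ZMod p) F] (hF : Nat.card F = p ^ m)
    (π : F) (hπ : IsPrimitiveRoot π (p ^ m - 1)) :
    IsCyclicCode (traceCode p m k π) ∧
    HasParityCheckPolynomial (traceCode p m k π)
      (minpoly (ZMod p) (-π⁻¹) * minpoly (ZMod p) ((π ^ ((p ^ k + 1) / 2))⁻¹)) ∧
    Module.finrank (ZMod p) (traceCode p m k π) = 2 * m ∧
    ∀ w : ℕ, (weightFrequency (traceCode p m k π) w : ℚ) =
      tableFrequency (weightTable p m (Nat.gcd m k)) w := by
  classical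
  have hpp : p.Prime := Fact.out
  have hpos : 0 < p ^ m := pow_pos hpp.pos m
  have : Finite F := Nat.finite_of_card_ne_zero (by rw [hF]; exact hpos.ne')
  have := Fintype.ofFinite F
  have hcard : Fintype.card F = p ^ m := by rw [← hF, Nat.card_eq_fintype_card]
  obtain ⟨n, l, hmn, hkl, hn, hl, hd2⟩ := parameters_of_padicValNat_lt hm hmk
  have hm0 : m ≠ 0 := by rintro rfl; simp at hm
  have hd0 : 0 < m.gcd k := Nat.gcd_pos_of_pos_left _ (Nat.pos_of_ne_zero hm0)
  have hn3 : 3 ≤ n := by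
    rwa [show m / m.gcd k = n from Nat.div_eq_of_eq_mul_right hd0 hmn] at hs
  have hm2 : Even m := hmn ▸ hd2.mul_right n
  have hk2 : Even k := hkl ▸ hd2.mul_right l
  have hkn : k * n = m * l := by
    conv_lhs => rw [hkl]
    conv_rhs => rw [hmn]
    ring
  obtain ⟨T, hσ, hψ⟩ := exists_frobeniusSetting hp hm2 hk2 hn hkn hF
  have hfix : T.fixed.card = p ^ m.gcd k := by
    rw [← card_pow_eq_self hm0 hF hπ]
    congr 1
    ext x
    simp [hσ]
  have hN : 0 < p ^ m - 1 := by
    have := Nat.one_lt_pow hm0 hpp.one_lt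
    omega
  have h3d : m.gcd k * 3 ≤ m := by
    conv_rhs => rw [hmn]
    exact Nat.mul_le_mul_left _ hn3
  have hπ0 : π ≠ 0 := hπ.ne_zero hN.ne'
  have hroot : ∀ x : F, x ≠ 0 → x ^ (p ^ m - 1) = 1 := fun x hx => by
    rw [← hcard]; exact FiniteField.pow_card_sub_one_eq_one x hx
  have r₁ := hroot _ (pow_ne_zero ((p ^ k + 1) / 2) hπ0)
  have r₂ := hroot _ (neg_ne_zero.2 hπ0)
  have hweight := two_mul_hammingNorm hp hm2 hl hkl hF hσ hψ hπ
  have hinj : Function.Injective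
      (traceWord (ZMod p) (p ^ m - 1) (π ^ ((p ^ k + 1) / 2)) (-π)) := by
    rw [injective_iff_map_eq_zero]
    rintro ⟨α, β⟩ h0
    have h1 := hweight α β
    rw [h0, hammingNorm_zero, Nat.cast_zero, mul_zero, eq_comm, mul_eq_zero] at h1
    have h2 : (p : ℂ) - 1 ≠ 0 := sub_ne_zero.2 (by exact_mod_cast hpp.one_lt.ne')
    have h3 := (sub_eq_zero.1 (h1.resolve_left h2)).symm
    have hm4 : m = 2 * (m / 2) := (Nat.mul_div_cancel' hm2.two_dvd).symm
    have hd4 : m.gcd k = 2 * (m.gcd k / 2) := (Nat.mul_div_cancel' hd2.two_dvd).symm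
    obtain ⟨h4, h5⟩ := eq_zero_of_formSum_add_eq T (g := p ^ (m / 2)) (g₀ := p ^ (m.gcd k / 2))
      (by rw [hcard, ← pow_mul, mul_comm, ← hm4]) (by rw [hfix, ← pow_mul, mul_comm, ← hd4])
      (by rw [hfix]; exact Nat.pow_le_pow_right hpp.pos (by omega))
      (hpp.two_le.trans (Nat.le_self_pow (by omega) p)) h3
    rw [h4, h5]
    rfl
  rw [traceCode_eq_range]
  refine ⟨isCyclicCode_range_traceWord r₁ r₂, ?_, ?_, fun w => ?_⟩
  · rw [← inv_neg]
    exact hasParityCheckPolynomial_range_traceWord r₁ r₂ hN hπ hinj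
  · have hfin : Module.finrank (ZMod p) F = m := by
      have := Module.card_eq_pow_finrank (K := ZMod p) (V := F)
      rw [hcard, ZMod.card] at this
      exact (Nat.pow_right_injective hpp.two_le this).symm
    rw [LinearMap.finrank_range_of_inj hinj, Module.finrank_prod, hfin, two_mul]
  · rw [weightFrequency_range _ hinj]
    exact card_hammingNorm_eq T hm2 hd2 hd0 (by omega) hcard hfix _ hweight w
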